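/- Let $\mathrm{Homeo}_+([0,1])$ be the group of increasing homeomorphisms of $[0,1]$ and $\mathrm{Diff}^1_+([0,1])$ its subgroup of $C^1$-diffeomorphisms. A subgroup $G\subset \mathrm{Diff}^1_+([0,1])$ is called $C^1$-close to the identity if there is a sequence $h_n\in \mathrm{Diff}^1_+([0,1])$ such that, for every $g\in G$, $h_n g h_n^{-1}\to \mathrm{id}$ in the $C^1$-topology as $n\to\infty$. A pair of successive fixed points of a subgroup $G\subset\mathrm{Homeo}_+([0,1])$ is a pair $\{a,b\}$, $a<b$, such that $(a,b)$ is a connected component of $[0,1]\setminus \mathrm{Fix}(g)$ for some $g\in G$. Two such pairs $\{a,b\}$, $\{c,d\}$ are linked if $(a,b)\cap\{c,d\}$ or $(c,d)\cap\{a,b\}$ consists of exactly one point, and $G$ is without linked fixed points if no two of its pairs of successive fixed points are linked. For a pair $\{a,b\}$ of successive fixed points of $G$, let $G_{[a,b]}=\{g\in G : g([a,b])=[a,b]\}$. A relative translation number is a group morphism $\tau_{a,b}\colon G_{[a,b]}\to(\mathbb{R},+)$ whose kernel is the set of $g\in G_{[a,b]}$ having a fixed point in $(a,b)$ and such that $\tau_{a,b}(g)>0$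 if and only if $g(x)-x>0$ for all $x\in(a,b)$. The group $G$ is totally rational if it is without linked fixed points and, for every pair $\{a,b\}$ of successive fixed points of $G$, there is a relative translation number $\tau_{a,b}$ and its image is cyclic, that is, of the form $\alpha\mathbb{Z}$. A $C^1$-contraction is a $C^1$-diffeomorphism $f$ of $[0,+\infty)$ with $f(x)<x$ for every $x\neq 0$. Its $C^1$-centralizer is the group of $C^1$-diffeomorphisms of $[0,+\infty)$ that commute with $f$. Theorem. There is a subgroup $G\subset \mathrm{Diff}^1_+([0,1])$ that is isomorphic to the free group $\mathbb{F}_2$, $C^1$-close to the identity, and totally rational. Moreover, there is a $C^1$-contraction $f$ of $[0,+\infty)$ whose $C^1$-centralizer contains a subgroup isomorphic to $\mathbb{F}_2$. -/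

import Mathlib

open Set Filter Topology

noncomputable section

namespace C1Interval

/-- A self-map of `S ⊆ ℝ`, seen as a real function (with irrelevant values outside `S`). -/
def toFun {S : Set ℝ} (f : S ≃o S) : ℝ → ℝ := by
  classical exact fun x => if h : x ∈ S then (f ⟨x, h⟩ : ℝ) else x

theorem toFun_coe {S : Set ℝ} (f : S ≃o S) (x : S) : toFun f x = f x := by
  simp [toFun]

theorem toFun_of_mem {S : Set ℝ} (f : S ≃o S) {x : ℝ} (h : x ∈ S) :
    toFun f x = f ⟨x, h⟩ := by
  simp [toFun, h]

/-- The group `Diff¹₊(S)` of orientation preserving `C¹`-diffeomorphisms of an interval `S ⊆ ℝ`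
(used for `S = [0,1]` and `S = [0,∞)`), inside the group `S ≃o S` of increasing bijections of `S`,
that is, the group `Homeo₊(S)` of orientation preserving homeomorphisms; the group law is
composition. Differentiability at an end point of `S` that belongs to `S` is one-sided. -/
def Diff (S : Set ℝ) : Subgroup (S ≃o S) where
  carrier := {f | ContDiffOn ℝ 1 (toFun f) S ∧ ContDiffOn ℝ 1 (toFun f⁻¹) S}
  one_mem' := by
    have h : ContDiffOn ℝ 1 (toFun (1 : S ≃o S)) S :=
      contDiffOn_id.congr fun x hx => by simp [toFun_of_mem _ hx]
    exact ⟨h, by simpa using h⟩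
  mul_mem' := by
    have key : ∀ f g : S ≃o S, ContDiffOn ℝ 1 (toFun f) S → ContDiffOn ℝ 1 (toFun g) S →
        ContDiffOn ℝ 1 (toFun (f * g)) S := by
      intro f g hf hg
      have hm : MapsTo (toFun g) S S := fun x hx => by
        rw [toFun_of_mem _ hx]; exact (g ⟨x, hx⟩).2
      refine (hf.comp hg hm).congr fun x hx => ?_
      simp only [Function.comp_apply]
      rw [toFun_of_mem _ hx, toFun_of_mem g hx, toFun_coe]
      rfl
    rintro f g ⟨hf, hf'⟩ ⟨hg, hg'⟩
    refine ⟨key f g hf hg, ?_⟩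
    rw [mul_inv_rev]
    exact key _ _ hg' hf'
  inv_mem' := by
    rintro f ⟨hf, hf'⟩
    exact ⟨hf', by simpa using hf⟩

/-- Convergence to the identity in the `C¹`-topology on `[0,1]`: uniform convergence of the maps
to the identity and of their derivatives to the constant `1`. -/
def TendstoIdC1 (u : ℕ → (Icc (0 : ℝ) 1 ≃o Icc (0 : ℝ) 1)) : Prop :=
  TendstoUniformlyOn (fun n => toFun (u n)) (fun x => x) atTop (Icc (0 : ℝ) 1) ∧
  TendstoUniformlyOn (fun n => derivWithin (toFun (u n)) (Icc (0 : ℝ) 1)) (fun _ => 1) atTop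
    (Icc (0 : ℝ) 1)

/-- `G` is a group of `C¹`-diffeomorphisms of `[0,1]` that is `C¹`-close to the identity: a single
sequence in `Diff¹₊([0,1])` conjugates all the elements of `G` to the identity in the limit. -/
def C1CloseToId (G : Subgroup (Icc (0 : ℝ) 1 ≃o Icc (0 : ℝ) 1)) : Prop :=
  G ≤ Diff (Icc (0 : ℝ) 1) ∧
  ∃ h : ℕ → (Icc (0 : ℝ) 1 ≃o Icc (0 : ℝ) 1), (∀ n, h n ∈ Diff (Icc (0 : ℝ) 1)) ∧
    ∀ g ∈ G, TendstoIdC1 fun n => h n * g * (h n)⁻¹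

/-- `{a, b}`, `a < b`, is a pair of successive fixed points of `G`: the interval `(a, b)` is a
connected component of `[0,1] \ Fix g` for some `g ∈ G` (the points `0` and `1` are always fixed,
so this says that `a` and `b` are fixed and that no point between them is). -/
def IsSuccessivePair (G : Subgroup (Icc (0 : ℝ) 1 ≃o Icc (0 : ℝ) 1))
    (a b : Icc (0 : ℝ) 1) : Prop :=
  a < b ∧ ∃ g ∈ G, g a = a ∧ g b = b ∧ ∀ x ∈ Ioo a b, g x ≠ x

/-- The pairs `{a, b}` and `{c, d}` are linked: `(a, b) ∩ {c, d}` or `(c, d) ∩ {a, b}` consists of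
exactly one point. -/
def Linked (a b c d : Icc (0 : ℝ) 1) : Prop :=
  (∃ x, Ioo a b ∩ {c, d} = {x}) ∨ (∃ x, Ioo c d ∩ {a, b} = {x})

/-- `G` is without linked fixed points. -/
def WithoutLinkedFixedPoints (G : Subgroup (Icc (0 : ℝ) 1 ≃o Icc (0 : ℝ) 1)) : Prop :=
  ∀ a b c d, IsSuccessivePair G a b → IsSuccessivePair G c d → ¬ Linked a b c d

/-- The stabilizer in `G` of the segment `[a, b]`. -/
def stab (G : Subgroup (Icc (0 : ℝ) 1 ≃o Icc (0 : ℝ) 1)) (a b : Icc (0 : ℝ) 1) :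
    Subgroup (Icc (0 : ℝ) 1 ≃o Icc (0 : ℝ) 1) where
  carrier := {g | g ∈ G ∧ g '' Icc a b = Icc a b}
  one_mem' := ⟨G.one_mem, by simp⟩
  mul_mem' := by
    rintro f g ⟨hf, hf'⟩ ⟨hg, hg'⟩
    refine ⟨G.mul_mem hf hg, ?_⟩
    rw [RelIso.coe_mul, image_comp, hg', hf']
  inv_mem' := by
    rintro f ⟨hf, hf'⟩
    refine ⟨G.inv_mem hf, ?_⟩
    conv_lhs => rw [← hf']
    rw [← image_comp, ← RelIso.coe_mul, inv_mul_cancel]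
    simp

/-- `τ` is a relative translation number of `G` on `[a, b]`: a morphism from the stabilizer of
`[a, b]` to `(ℝ, +)` whose kernel is the set of elements having a fixed point in `(a, b)`, and which
is positive at `g` if and only if `g x - x > 0` on `(a, b)`. -/
def IsTranslationNumber (G : Subgroup (Icc (0 : ℝ) 1 ≃o Icc (0 : ℝ) 1)) (a b : Icc (0 : ℝ) 1)
    (τ : stab G a b →* Multiplicative ℝ) : Prop :=
  (∀ g : stab G a b, τ g = 1 ↔ ∃ x ∈ Ioo a b, g.1 x = x) ∧
  (∀ g : stab G a b, 0 < (τ g).toAdd ↔ ∀ x ∈ Ioo a b, x < g.1 x)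

/-- `G` is totally rational: it is without linked fixed points and, for every pair `{a, b}` of
successive fixed points, the relative translation number has cyclic image. (Two relative translation
numbers on `[a, b]` have the same kernel, hence isomorphic images.) -/
def TotallyRational (G : Subgroup (Icc (0 : ℝ) 1 ≃o Icc (0 : ℝ) 1)) : Prop :=
  WithoutLinkedFixedPoints G ∧
  ∀ a b, IsSuccessivePair G a b →
    ∃ τ : stab G a b →* Multiplicative ℝ, IsTranslationNumber G a b τ ∧ IsCyclic τ.range

/-- `f` is a `C¹`-contraction of the half line `[0,∞)`. -/
def IsC1Contraction (f : Ici (0 : ℝ) ≃o Ici (0 : ℝ)) : Prop :=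
  f ∈ Diff (Ici (0 : ℝ)) ∧ ∀ x : Ici (0 : ℝ), (x : ℝ) ≠ 0 → f x < x

/-- The `C¹`-centralizer of `f`: the `C¹`-diffeomorphisms of `[0,∞)` that commute with `f`. -/
def C1Centralizer (f : Ici (0 : ℝ) ≃o Ici (0 : ℝ)) : Subgroup (Ici (0 : ℝ) ≃o Ici (0 : ℝ)) :=
  Diff (Ici (0 : ℝ)) ⊓ Subgroup.centralizer {f}

end C1Interval

end

open Set Filter Topology

noncomputable section

namespace C1Interval

/-! Write `g' = exp u`. Conjugating `g` by a diffeomorphism with derivative `exp (ψ - c)`, `c`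
constant, turns `u` into `u + ψ ∘ g - ψ`, up to a change of variable. So a group is C¹-close to the
identity as soon as one sequence `ψ n` makes the cocycle `u` almost a coboundary for each of its
elements. `CloseWith` records this together with `u = 0` at the end points, which lets maps be glued
side by side in a C¹ way. All constructions are then carried out on densities.

Cut the open interval into cells `[m, m+1]`, `m ∈ ℤ`, in a coordinate whose density decays
polynomially. Homeomorphisms of bounded displacement become tangent to the identity at the end
points, and flattening the density makes them close to the identity. Hence closeness survives adding
a translation of the cells to a group supported in one cell (`exists_isDensitySeq_wreath`), and
letting countably many representations act in separate cells (`exists_isDensitySeq_union`). Total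
rationality survives too: a pair of successive fixed points is `{0,1}`, where the number of cells
translated is the translation number, or it lies in one cell (`integrallyRational_cellGroup`).

Starting from the trivial group, this realizes iterated wreath products of `ℤ`
(`IteratedWreath.exists_realization`). Free groups are residually of this kind:
`exists_injective_path` unfolds the path of a reduced word in a Schreier graph, one letter at a
time. Each nontrivial word is thus detected by a representation whose generators can be conjugated
as near to the identity as desired; putting these representations in cells going to the ends gives a
faithful one (`exists_faithful_representation`).

For the contraction, the half line is cut into cells too, `f` translates them by `-1`, and a group
close to the identity acts in the same way in every cell, hence commutes with `f`. The cell `-k`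
carries the density `exp (φ k)`, where `φ` again brings the group close to the identity, so that the
derivatives tend to `1` at the origin. For `f` itself to be C¹ there, `φ (k+1) - φ k` must tend to
`0`, and for the origin to be at finite distance `φ` must grow slowly; slowing down and averaging
`ψ` achieves both (`exists_slow_densitySeq`). -/

/-! ### Homeomorphisms with a continuous logarithmic derivative -/

/-- `g` is differentiable on `S`, with derivative `exp u` for a continuous function `u`. -/
def HasLogDeriv {S : Set ℝ} (g : S ≃o S) (u : S → ℝ) : Prop :=
  Continuous u ∧ ∀ x : S, HasDerivWithinAt (toFun g) (Real.exp (u x)) S x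

theorem toFun_mapsTo {S : Set ℝ} (f : S ≃o S) : MapsTo (toFun f) S S := fun x hx => by
  rw [toFun_of_mem _ hx]; exact (f ⟨x, hx⟩).2

theorem toFun_mul {S : Set ℝ} (f g : S ≃o S) {x : ℝ} (hx : x ∈ S) :
    toFun (f * g) x = toFun f (toFun g x) := by
  rw [toFun_of_mem _ hx, toFun_of_mem g hx, toFun_coe]; rfl

theorem continuousOn_toFun {S : Set ℝ} [S.OrdConnected] (g : S ≃o S) :
    ContinuousOn (toFun g) S := by
  rw [continuousOn_iff_continuous_domRestrict]
  have : S.domRestrict (toFun g) = fun x => (g x : ℝ) := by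
    ext x; exact toFun_coe g x
  rw [this]
  exact continuous_subtype_val.comp g.continuous

theorem hasLogDeriv_one {S : Set ℝ} : HasLogDeriv (1 : S ≃o S) (fun _ => 0) := by
  refine ⟨continuous_const, fun x => ?_⟩
  rw [Real.exp_zero]
  exact (hasDerivWithinAt_id _ _).congr (fun y hy => by simp [toFun_of_mem _ hy])
    (by simp [toFun_coe])

/-- The logarithmic derivative is an additive cocycle; this form of the chain rule is what makes the
estimates below additive. -/
theorem HasLogDeriv.mul {S : Set ℝ} [S.OrdConnected] {f g : S ≃o S} {u v : S → ℝ}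
    (hf : HasLogDeriv f u) (hg : HasLogDeriv g v) :
    HasLogDeriv (f * g) (fun x => u (g x) + v x) := by
  refine ⟨(hf.1.comp g.continuous).add hg.1, fun x => ?_⟩
  have h1 : HasDerivWithinAt (toFun f) (Real.exp (u (g x))) S (toFun g x) := by
    rw [toFun_coe]; exact hf.2 (g x)
  have h2 := h1.comp (x : ℝ) (hg.2 x) (toFun_mapsTo g)
  rw [← Real.exp_add] at h2
  exact h2.congr (fun y hy => toFun_mul f g hy) (toFun_mul f g x.2)

theorem HasLogDeriv.inv {S : Set ℝ} [S.OrdConnected] {f : S ≃o S} {u : S → ℝ}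
    (hf : HasLogDeriv f u) : HasLogDeriv f⁻¹ (fun x => - u (f⁻¹ x)) := by
  refine ⟨(hf.1.comp f⁻¹.continuous).neg, fun x => ?_⟩
  have hc := continuousOn_toFun f⁻¹ x x.2
  have h1 : HasDerivWithinAt (toFun f) (Real.exp (u (f⁻¹ x))) S (toFun f⁻¹ x) := by
    rw [toFun_coe]; exact hf.2 _
  have ht : Tendsto (toFun f⁻¹) (𝓝[S] (x : ℝ)) (𝓝[S] (toFun f⁻¹ x)) :=
    tendsto_nhdsWithin_iff.2 ⟨hc, eventually_nhdsWithin_of_forall (toFun_mapsTo _)⟩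
  have h2 : HasFDerivWithinAt (toFun f)
      ((ContinuousLinearEquiv.unitsEquivAut ℝ (Units.mk0 _ (Real.exp_ne_zero (u (f⁻¹ x)))) :
        ℝ ≃L[ℝ] ℝ) : ℝ →L[ℝ] ℝ) S (toFun f⁻¹ x) := h1
  have h3 : HasDerivWithinAt (toFun f⁻¹) (Real.exp (u (f⁻¹ x)))⁻¹ S x :=
    h2.of_local_left_inverse ht x.2 (eventually_nhdsWithin_of_forall fun y hy => by
      rw [← toFun_mul f f⁻¹ hy, mul_inv_cancel, toFun_of_mem _ hy]; rfl)
  rwa [← Real.exp_neg] at h3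

theorem HasLogDeriv.contDiffOn {S : Set ℝ} (hS : UniqueDiffOn ℝ S) {f : S ≃o S} {u : S → ℝ}
    (hf : HasLogDeriv f u) : ContDiffOn ℝ 1 (toFun f) S := by
  rw [contDiffOn_one_iff_derivWithin hS]
  refine ⟨fun x hx => (hf.2 ⟨x, hx⟩).differentiableWithinAt, ?_⟩
  rw [continuousOn_iff_continuous_domRestrict]
  have : S.domRestrict (derivWithin (toFun f) S) = fun x => Real.exp (u x) := by
    ext x; exact (hf.2 x).derivWithin (hS x x.2)
  rw [this]
  exact Real.continuous_exp.comp hf.1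

theorem HasLogDeriv.mem_Diff {S : Set ℝ} [S.OrdConnected] (hS : UniqueDiffOn ℝ S) {f : S ≃o S}
    {u : S → ℝ} (hf : HasLogDeriv f u) : f ∈ Diff S :=
  ⟨hf.contDiffOn hS, hf.inv.contDiffOn hS⟩

/-- A continuous function on a closed set is the restriction of a continuous function. -/
theorem exists_continuous_extension {S : Set ℝ} (hS : IsClosed S) {u : S → ℝ}
    (hu : Continuous u) : ∃ U : ℝ → ℝ, Continuous U ∧ ∀ x : S, U x = u x := by
  obtain ⟨U, hU⟩ := ContinuousMap.exists_restrict_eq hS ⟨u, hu⟩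
  exact ⟨U, U.continuous, fun x => by
    simpa using DFunLike.congr_fun hU x⟩

/-- It is enough to know the derivative off a countable set, provided that it extends
continuously. -/
theorem hasLogDeriv_of_countable {S : Set ℝ} [S.OrdConnected] (hS : IsClosed S) {g : S ≃o S}
    {u : S → ℝ} (hu : Continuous u) {E : Set ℝ} (hE : E.Countable)
    (h : ∀ x : S, (x : ℝ) ∉ E → HasDerivAt (toFun g) (Real.exp (u x)) x) : HasLogDeriv g u := by
  refine ⟨hu, fun x => ?_⟩
  obtain ⟨U, hU, hUu⟩ := exists_continuous_extension hS hu
  have hc : Continuous fun y => Real.exp (U y) := Real.continuous_exp.comp hU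
  -- The fundamental theorem of calculus tolerates a countable exceptional set; the primitive of a
  -- continuous function is then differentiable everywhere.
  have key : ∀ y ∈ S, toFun g y = toFun g x + ∫ s in (x : ℝ)..y, Real.exp (U s) := by
    intro y hy
    have hsub : uIcc (x : ℝ) y ⊆ S := OrdConnected.uIcc_subset ‹_› x.2 hy
    rw [MeasureTheory.integral_eq_of_hasDerivAt_off_countable (toFun g) _ hE
      ((continuousOn_toFun g).mono hsub) _ (hc.intervalIntegrable _ _)]
    · ring
    · intro z hz
      have hzS : z ∈ S := hsub (Ioo_subset_Icc_self hz.1)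
      have := h ⟨z, hzS⟩ hz.2
      rwa [← hUu] at this
  have hd : HasDerivAt (fun y => toFun g x + ∫ s in (x : ℝ)..y, Real.exp (U s))
      (Real.exp (U x)) x :=
    ((intervalIntegral.integral_hasDerivAt_right (hc.intervalIntegrable _ _)
      hc.stronglyMeasurable.stronglyMeasurableAtFilter hc.continuousAt)).const_add _
  rw [← hUu]
  exact hd.hasDerivWithinAt.congr key (key x x.2)

theorem Icc_zero_one_uniqueDiffOn : UniqueDiffOn ℝ (Icc (0 : ℝ) 1) :=
  uniqueDiffOn_Icc zero_lt_one

/-- A continuous density on `[0,1]` is, up to normalization, the derivative of a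
diffeomorphism. -/
theorem exists_hasLogDeriv_sub_const {ψ : Icc (0 : ℝ) 1 → ℝ} (hψ : Continuous ψ) :
    ∃ (h : Icc (0 : ℝ) 1 ≃o Icc (0 : ℝ) 1) (c : ℝ), HasLogDeriv h (fun x => ψ x - c) := by
  obtain ⟨U, hU, hUu⟩ := exists_continuous_extension isClosed_Icc hψ
  have hc : Continuous fun y => Real.exp (U y) := Real.continuous_exp.comp hU
  set Z : ℝ := ∫ s in (0 : ℝ)..1, Real.exp (U s) with hZ
  have hZpos : 0 < Z := intervalIntegral.intervalIntegral_pos_of_pos (hc.intervalIntegrable _ _)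
    (fun x => Real.exp_pos _) zero_lt_one
  set H : ℝ → ℝ := fun x => (∫ s in (0 : ℝ)..x, Real.exp (U s)) / Z with hH
  have hderiv : ∀ x, HasDerivAt H (Real.exp (U x - Real.log Z)) x := by
    intro x
    rw [Real.exp_sub, Real.exp_log hZpos]
    exact (intervalIntegral.integral_hasDerivAt_right (hc.intervalIntegrable _ _)
      hc.stronglyMeasurable.stronglyMeasurableAtFilter hc.continuousAt).div_const Z
  have hmono : StrictMono H := strictMono_of_deriv_pos fun x => by
    rw [(hderiv x).deriv]; exact Real.exp_pos _
  have h0 : H 0 = 0 := by simp [hH]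
  have h1 : H 1 = 1 := by simp only [hH]; rw [← hZ]; exact div_self hZpos.ne'
  have hHc : Continuous H := continuous_iff_continuousAt.2 fun x => (hderiv x).continuousAt
  have hmaps : ∀ x : Icc (0 : ℝ) 1, H x ∈ Icc (0 : ℝ) 1 := fun x =>
    ⟨h0.symm.le.trans (hmono.monotone x.2.1), (hmono.monotone x.2.2).trans h1.le⟩
  let F : Icc (0 : ℝ) 1 → Icc (0 : ℝ) 1 := fun x => ⟨H x, hmaps x⟩
  have hF : StrictMono F := fun x y hxy => hmono hxy
  have hsurj : Function.Surjective F := by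
    intro y
    obtain ⟨x, hx, hxy⟩ := intermediate_value_Icc (zero_le_one' ℝ) hHc.continuousOn
      (show (y : ℝ) ∈ Icc (H 0) (H 1) by rw [h0, h1]; exact y.2)
    exact ⟨⟨x, hx⟩, Subtype.ext hxy⟩
  refine ⟨hF.orderIsoOfSurjective F hsurj, Real.log Z, hψ.sub continuous_const, fun x => ?_⟩
  simp only [← hUu]
  have : ∀ y ∈ Icc (0 : ℝ) 1, toFun (hF.orderIsoOfSurjective F hsurj) y = H y := fun y hy => by
    rw [toFun_of_mem _ hy]; rfl
  exact (hderiv x).hasDerivWithinAt.congr this (this x x.2)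

/-- If `g' - 1` is small on `[0,1]` then so is `g - id`. -/
theorem HasLogDeriv.abs_sub_le {g : Icc (0 : ℝ) 1 ≃o Icc (0 : ℝ) 1} {u : Icc (0 : ℝ) 1 → ℝ}
    (hg : HasLogDeriv g u) {ε : ℝ} (h : ∀ x, |Real.exp (u x) - 1| ≤ ε) (x : Icc (0 : ℝ) 1) :
    |(g x : ℝ) - x| ≤ ε := by
  have hd : ∀ y ∈ Icc (0 : ℝ) 1, HasDerivWithinAt (fun y => toFun g y - y)
      (if hy : y ∈ Icc (0 : ℝ) 1 then Real.exp (u ⟨y, hy⟩) - 1 else 0) (Icc 0 1) y := by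
    intro y hy
    rw [dif_pos hy]
    exact (hg.2 ⟨y, hy⟩).sub (hasDerivWithinAt_id _ _)
  have h01 : (0 : ℝ) ∈ Icc (0 : ℝ) 1 := ⟨le_rfl, zero_le_one⟩
  have := (convex_Icc (0 : ℝ) 1).norm_image_sub_le_of_norm_hasDerivWithin_le (C := ε) hd
    (fun y hy => by rw [dif_pos hy]; exact h ⟨y, hy⟩) h01 x.2
  have hg0 : toFun g 0 = 0 := by
    rw [toFun_of_mem _ h01]
    exact congrArg Subtype.val (g.map_bot)
  rw [hg0, toFun_coe, Real.norm_eq_abs, Real.norm_eq_abs] at this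
  have hx1 : |(x : ℝ) - 0| ≤ 1 := by
    rw [sub_zero, abs_of_nonneg x.2.1]; exact x.2.2
  have he : 0 ≤ ε := (abs_nonneg _).trans (h x)
  calc |(g x : ℝ) - x| = |(g x : ℝ) - x - (0 - 0)| := by ring_nf
    _ ≤ ε * |(x : ℝ) - 0| := this
    _ ≤ ε := by nlinarith

/-! ### Homeomorphisms of the line acting on an interval -/

/-- A strictly increasing parametrization by `ℝ` of a linear order deprived of lower bounds and
upper bounds of the image. -/
structure Chart (α : Type*) [LinearOrder α] where
  /-- the parametrization -/
  X : ℝ → α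
  strictMono : StrictMono X
  cover : ∀ s, s ∈ range X ∨ (∀ t, s < X t) ∨ (∀ t, X t < s)

namespace Chart

variable {α : Type*} [LinearOrder α] (C : Chart α)

/-- The coordinate of a point of the image of a chart. -/
def coord (s : α) : ℝ := Function.invFun C.X s

@[simp] theorem coord_X (t : ℝ) : C.coord (C.X t) = t :=
  Function.leftInverse_invFun C.strictMono.injective t

/-- Extension of a function of the coordinate by the identity. -/
def extFun (g : ℝ → ℝ) (s : α) : α := by
  classical exact if s ∈ range C.X then C.X (g (C.coord s)) else s

@[simp] theorem extFun_X (g : ℝ → ℝ) (t : ℝ) : C.extFun g (C.X t) = C.X (g t) := by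
  simp [extFun]

theorem extFun_of_notMem (g : ℝ → ℝ) {s : α} (hs : s ∉ range C.X) : C.extFun g s = s := by
  rw [extFun, if_neg hs]

theorem extFun_strictMono {g : ℝ → ℝ} (hg : StrictMono g) : StrictMono (C.extFun g) := by
  intro s s' h
  rcases C.cover s with ⟨t, rfl⟩ | hs | hs <;> rcases C.cover s' with ⟨t', rfl⟩ | hs' | hs'
  · simpa using C.strictMono (hg (C.strictMono.lt_iff_lt.1 h))
  · exact absurd h (hs' t).le.not_gt
  · rw [extFun_X, C.extFun_of_notMem g (fun ⟨t', h'⟩ => (hs' t').ne h')]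
    exact hs' _
  · rw [extFun_X, C.extFun_of_notMem g (fun ⟨t', h'⟩ => (hs t').ne' h')]
    exact hs _
  · rwa [C.extFun_of_notMem g (fun ⟨t', h'⟩ => (hs t').ne' h'),
      C.extFun_of_notMem g (fun ⟨t', h'⟩ => (hs' t').ne' h')]
  · rwa [C.extFun_of_notMem g (fun ⟨t', h'⟩ => (hs t').ne' h'),
      C.extFun_of_notMem g (fun ⟨t', h'⟩ => (hs' t').ne h')]
  · exact absurd h (hs t').le.not_gt
  · rwa [C.extFun_of_notMem g (fun ⟨t', h'⟩ => (hs t').ne h'),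
      C.extFun_of_notMem g (fun ⟨t', h'⟩ => (hs' t').ne' h')]
  · rwa [C.extFun_of_notMem g (fun ⟨t', h'⟩ => (hs t').ne h'),
      C.extFun_of_notMem g (fun ⟨t', h'⟩ => (hs' t').ne h')]

theorem extFun_comp (f g : ℝ → ℝ) (s : α) : C.extFun f (C.extFun g s) = C.extFun (f ∘ g) s := by
  by_cases hs : s ∈ range C.X
  · obtain ⟨t, rfl⟩ := hs; simp
  · simp [C.extFun_of_notMem _ hs]

theorem extFun_id (s : α) : C.extFun id s = s := by
  by_cases hs : s ∈ range C.X
  · obtain ⟨t, rfl⟩ := hs; simp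
  · simp [C.extFun_of_notMem _ hs]

/-- The action on `α` of the homeomorphisms of the line, through a chart. -/
def ext : (ℝ ≃o ℝ) →* (α ≃o α) where
  toFun g := Equiv.toOrderIso
    { toFun := C.extFun g
      invFun := C.extFun g.symm
      left_inv := fun s => by
        rw [extFun_comp, show ⇑g.symm ∘ ⇑g = id from funext g.symm_apply_apply]; exact C.extFun_id s
      right_inv := fun s => by
        rw [extFun_comp, show ⇑g ∘ ⇑g.symm = id from funext g.apply_symm_apply]; exact C.extFun_id s }
    (C.extFun_strictMono g.strictMono).monotone (C.extFun_strictMono g.symm.strictMono).monotone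
  map_one' := by
    ext s; exact C.extFun_id s
  map_mul' f g := by
    ext s; exact (C.extFun_comp f g s).symm

@[simp] theorem ext_X (g : ℝ ≃o ℝ) (t : ℝ) : C.ext g (C.X t) = C.X (g t) :=
  C.extFun_X g t

theorem ext_of_notMem (g : ℝ ≃o ℝ) {s : α} (hs : s ∉ range C.X) : C.ext g s = s :=
  C.extFun_of_notMem g hs

theorem ext_injective : Function.Injective C.ext := by
  intro f g h
  ext t
  have := DFunLike.congr_fun h (C.X t)
  rw [ext_X, ext_X] at this
  exact C.strictMono.injective this

theorem Ioo_subset_range (a b : ℝ) : Ioo (C.X a) (C.X b) ⊆ range C.X := by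
  intro s hs
  rcases C.cover s with h | h | h
  · exact h
  · exact absurd hs.1 (h a).le.not_gt
  · exact absurd hs.2 (h b).le.not_gt

/-- Extension by `0` of a function of the coordinate. -/
def lift (V : ℝ → ℝ) (s : α) : ℝ := by
  classical exact if s ∈ range C.X then V (C.coord s) else 0

@[simp] theorem lift_X (V : ℝ → ℝ) (t : ℝ) : C.lift V (C.X t) = V t := by
  simp [lift]

theorem lift_of_notMem (V : ℝ → ℝ) {s : α} (hs : s ∉ range C.X) : C.lift V s = 0 := by
  rw [lift, if_neg hs]

variable [TopologicalSpace α] [OrderTopology α]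

theorem continuousAt_coord (t : ℝ) : ContinuousAt C.coord (C.X t) := by
  have hr : ∀ᶠ s in 𝓝 (C.X t), s ∈ range C.X :=
    mem_of_superset (Ioo_mem_nhds (C.strictMono (sub_one_lt t)) (C.strictMono (lt_add_one t)))
      (C.Ioo_subset_range _ _)
  rw [ContinuousAt, coord_X, tendsto_order]
  constructor
  · intro a ha
    filter_upwards [hr, lt_mem_nhds (C.strictMono ha)]
    rintro _ ⟨s, rfl⟩ h
    simpa using C.strictMono.lt_iff_lt.1 h
  · intro a ha
    filter_upwards [hr, gt_mem_nhds (C.strictMono ha)]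
    rintro _ ⟨s, rfl⟩ h
    simpa using C.strictMono.lt_iff_lt.1 h

theorem eventually_mem_range (t : ℝ) : ∀ᶠ s in 𝓝 (C.X t), s ∈ range C.X :=
  mem_of_superset (Ioo_mem_nhds (C.strictMono (sub_one_lt t)) (C.strictMono (lt_add_one t)))
    (C.Ioo_subset_range _ _)

/-- A limit at an end is required only if some point of `α` lies beyond that end: at both ends for
`[0,1]`, at the origin only for the half line. -/
theorem continuous_lift {V : ℝ → ℝ} (hV : Continuous V)
    (hbot : ∀ s, (∀ t, s < C.X t) → Tendsto V atBot (𝓝 0))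
    (htop : ∀ s, (∀ t, C.X t < s) → Tendsto V atTop (𝓝 0)) : Continuous (C.lift V) := by
  rw [continuous_iff_continuousAt]
  intro s
  rcases C.cover s with ⟨t, rfl⟩ | hs | hs
  · have h1 : ContinuousAt (fun s => V (C.coord s)) (C.X t) :=
      ContinuousAt.comp hV.continuousAt (C.continuousAt_coord t)
    refine h1.congr ?_
    filter_upwards [C.eventually_mem_range t]
    rintro _ ⟨s, rfl⟩
    simp
  · rw [ContinuousAt, C.lift_of_notMem V (fun ⟨t', h'⟩ => (hs t').ne' h'), Metric.tendsto_nhds]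
    intro ε hε
    obtain ⟨a, ha⟩ := eventually_atBot.1 ((Metric.tendsto_nhds.1 (hbot s hs)) ε hε)
    filter_upwards [gt_mem_nhds (hs a)] with s' hs'
    by_cases hr : s' ∈ range C.X
    · obtain ⟨t, rfl⟩ := hr
      rw [lift_X]; exact ha t (C.strictMono.lt_iff_lt.1 hs').le
    · rw [C.lift_of_notMem V hr]; simpa using hε
  · rw [ContinuousAt, C.lift_of_notMem V (fun ⟨t', h'⟩ => (hs t').ne h'), Metric.tendsto_nhds]
    intro ε hε
    obtain ⟨a, ha⟩ := eventually_atTop.1 ((Metric.tendsto_nhds.1 (htop s hs)) ε hε)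
    filter_upwards [lt_mem_nhds (hs a)] with s' hs'
    by_cases hr : s' ∈ range C.X
    · obtain ⟨t, rfl⟩ := hr
      rw [lift_X]; exact ha t (C.strictMono.lt_iff_lt.1 hs').le
    · rw [C.lift_of_notMem V hr]; simpa using hε

end Chart

/-- The logarithmic derivative of a homeomorphism given in a chart with density `exp a`. -/
theorem Chart.hasLogDeriv_ext {S : Set ℝ} [S.OrdConnected] (hS : IsClosed S) (C : Chart S)
    (hC : (range C.X)ᶜ.Countable) {E : Set ℝ} (hE : E.Countable) {a b : ℝ → ℝ}
    (ha : ∀ t ∉ E, HasDerivAt (fun t => (C.X t : ℝ)) (Real.exp (a t)) t) {g : ℝ ≃o ℝ}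
    (hg : ∀ t ∉ E, HasDerivAt g (Real.exp (b t)) t) (hgE : ∀ t ∉ E, g t ∉ E)
    (hSX : ∀ t, S ∈ 𝓝 (C.X t : ℝ))
    {v : S → ℝ} (hv : Continuous v) (hvX : ∀ t ∉ E, v (C.X t) = a (g t) - a t + b t) :
    HasLogDeriv (C.ext g) v := by
  have hE' : (((↑) : S → ℝ) '' ((range C.X)ᶜ ∪ C.X '' E)).Countable :=
    (hC.union (hE.image _)).image _
  refine hasLogDeriv_of_countable hS hv hE' fun x hx => ?_
  have hx1 : x ∈ range C.X := by
    by_contra h; exact hx ⟨x, Or.inl h, rfl⟩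
  obtain ⟨t, rfl⟩ := hx1
  have ht : t ∉ E := fun h => hx ⟨C.X t, Or.inr ⟨t, h, rfl⟩, rfl⟩
  classical
  set Y : ℝ → ℝ := fun y => if h : y ∈ S then C.coord ⟨y, h⟩ else 0 with hY
  have hYS : ∀ s : S, Y s = C.coord s := fun s => by simp [hY]
  have hmap : 𝓝 (C.X t : ℝ) = map ((↑) : S → ℝ) (𝓝 (C.X t)) :=
    (map_nhds_subtype_coe_eq_nhds (C.X t).2 (hSX t)).symm
  have hYc : ContinuousAt Y (C.X t) := by
    rw [ContinuousAt, hmap, tendsto_map'_iff]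
    exact (C.continuousAt_coord t).congr (Eventually.of_forall fun s => (hYS s).symm)
  have hev : ∀ᶠ y in 𝓝 (C.X t : ℝ), (fun t => (C.X t : ℝ)) (Y y) = y := by
    rw [hmap, eventually_map]
    filter_upwards [C.eventually_mem_range t]
    rintro _ ⟨s, rfl⟩
    simp [hYS]
  have hYt : Y (C.X t) = t := by rw [hYS, C.coord_X]
  have hYd : HasDerivAt Y (Real.exp (a t))⁻¹ (C.X t) :=
    HasDerivAt.of_local_left_inverse hYc (by rw [hYt]; exact ha t ht) (Real.exp_ne_zero _) hev
  have h1 : HasDerivAt g (Real.exp (b t)) (Y (C.X t)) := by rw [hYt]; exact hg t ht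
  have h2 : HasDerivAt (fun t => (C.X t : ℝ)) (Real.exp (a (g t))) (g (Y (C.X t))) := by
    rw [hYt]; exact ha _ (hgE t ht)
  have h3 := h2.comp (C.X t : ℝ) (h1.comp (C.X t : ℝ) hYd)
  -- Chain rule for `X ∘ g ∘ X⁻¹`: the chart contributes the coboundary of `a`.
  have h4 : Real.exp (a (g t)) * (Real.exp (b t) * (Real.exp (a t))⁻¹) =
      Real.exp (v (C.X t)) := by
    rw [hvX t ht, ← Real.exp_neg, ← Real.exp_add, ← Real.exp_add]; congr 1; ring
  rw [h4] at h3
  refine h3.congr_of_eventuallyEq ?_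
  rw [EventuallyEq, hmap, eventually_map]
  filter_upwards [C.eventually_mem_range t]
  rintro _ ⟨s, rfl⟩
  simp [hYS, toFun_coe]

/-! ### Homeomorphisms of the line made of homeomorphisms of the unit cells -/

/-- `m + x ↦ m + c + F m x` for `m : ℤ` and `x ∈ [0,1]`. -/
def glueFun (c : ℤ) (F : ℤ → (Icc (0 : ℝ) 1 ≃o Icc (0 : ℝ) 1)) (t : ℝ) : ℝ :=
  ⌊t⌋ + c + F ⌊t⌋ ⟨Int.fract t, Int.fract_nonneg t, (Int.fract_lt_one t).le⟩

theorem orderIso_zero (f : Icc (0 : ℝ) 1 ≃o Icc (0 : ℝ) 1) : f 0 = 0 := f.map_bot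

theorem orderIso_one (f : Icc (0 : ℝ) 1 ≃o Icc (0 : ℝ) 1) : f 1 = 1 := f.map_top

theorem orderIso_lt_one {f : Icc (0 : ℝ) 1 ≃o Icc (0 : ℝ) 1} {x : Icc (0 : ℝ) 1}
    (hx : (x : ℝ) < 1) : (f x : ℝ) < 1 := by
  have : f x < f 1 := f.strictMono (show x < 1 from hx)
  rwa [orderIso_one] at this

/-- Every real number is the sum of an integer and of an element of `[0,1)`. -/
theorem exists_int_add (t : ℝ) : ∃ (m : ℤ) (x : Icc (0 : ℝ) 1), (x : ℝ) < 1 ∧ t = m + x :=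
  ⟨⌊t⌋, ⟨Int.fract t, Int.fract_nonneg t, (Int.fract_lt_one t).le⟩, Int.fract_lt_one t,
    (Int.floor_add_fract t).symm⟩

theorem floor_int_add {m : ℤ} {x : Icc (0 : ℝ) 1} (hx : (x : ℝ) < 1) :
    ⌊(m : ℝ) + x⌋ = m := by
  rw [Int.floor_eq_iff]; exact ⟨by linarith [x.2.1], by linarith⟩

theorem fract_int_add {m : ℤ} {x : Icc (0 : ℝ) 1} (hx : (x : ℝ) < 1) :
    Int.fract ((m : ℝ) + x) = x := by
  rw [Int.fract, floor_int_add hx]; ring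

/-- The value `x = 1` is allowed although the floor then belongs to the next cell: the two formulas
agree because every `F m` fixes `0` and `1`. -/
theorem glueFun_add (c : ℤ) (F : ℤ → (Icc (0 : ℝ) 1 ≃o Icc (0 : ℝ) 1)) (m : ℤ)
    (x : Icc (0 : ℝ) 1) : glueFun c F (m + x) = m + c + F m x := by
  rcases lt_or_eq_of_le x.2.2 with hx | hx
  · simp only [glueFun, floor_int_add hx, fract_int_add hx]
  · have h1 : x = 1 := Subtype.ext hx
    subst h1
    have h2 : (m : ℝ) + ((1 : Icc (0 : ℝ) 1) : ℝ) = ((m + 1 : ℤ) : ℝ) + ((0 : Icc (0 : ℝ) 1) : ℝ) := by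
      push_cast; simp
    rw [h2, orderIso_one]
    have h0 : ((0 : Icc (0 : ℝ) 1) : ℝ) < 1 := zero_lt_one
    simp only [glueFun, floor_int_add h0, fract_int_add h0]
    have : F (m + 1) ⟨((0 : Icc (0 : ℝ) 1) : ℝ), (0 : Icc (0 : ℝ) 1).2⟩ = 0 := orderIso_zero _
    rw [this]; push_cast; simp; ring

theorem glueFun_strictMono (c : ℤ) (F : ℤ → (Icc (0 : ℝ) 1 ≃o Icc (0 : ℝ) 1)) :
    StrictMono (glueFun c F) := by
  intro s t h
  obtain ⟨m, x, hx, rfl⟩ := exists_int_add s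
  obtain ⟨n, y, hy, rfl⟩ := exists_int_add t
  rw [glueFun_add, glueFun_add]
  have hmn : m ≤ n := by
    have := Int.floor_mono h.le
    rwa [floor_int_add hx, floor_int_add hy] at this
  rcases hmn.eq_or_lt with rfl | hmn
  · have : x < y := show (x : ℝ) < y by linarith
    have : (F m x : ℝ) < F m y := (F m).strictMono this
    linarith
  · have h1 : (m : ℝ) + 1 ≤ n := by exact_mod_cast hmn
    have h2 := orderIso_lt_one (f := F m) hx
    have h3 := (F n y).2.1
    linarith

theorem glueFun_comp (c c' : ℤ) (F F' : ℤ → (Icc (0 : ℝ) 1 ≃o Icc (0 : ℝ) 1)) (t : ℝ) :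
    glueFun c F (glueFun c' F' t) = glueFun (c + c') (fun m => F (m + c') * F' m) t := by
  obtain ⟨m, x, hx, rfl⟩ := exists_int_add t
  rw [glueFun_add, glueFun_add]
  have := glueFun_add c F (m + c') (F' m x)
  push_cast at this ⊢
  rw [this, RelIso.mul_apply]; ring

theorem glueFun_one (t : ℝ) : glueFun 0 1 t = t := by
  obtain ⟨m, x, hx, rfl⟩ := exists_int_add t
  rw [glueFun_add]; simp

/-- The increasing homeomorphism `m + x ↦ m + c + F m x` of the line. -/
def glue (c : ℤ) (F : ℤ → (Icc (0 : ℝ) 1 ≃o Icc (0 : ℝ) 1)) : ℝ ≃o ℝ :=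
  Equiv.toOrderIso
    { toFun := glueFun c F
      invFun := glueFun (-c) fun m => (F (m - c))⁻¹
      left_inv := fun t => by
        rw [glueFun_comp]; convert glueFun_one t using 2
        · ring
        · ext m; simp
      right_inv := fun t => by
        rw [glueFun_comp]; convert glueFun_one t using 2
        · ring
        · ext m; simp [← sub_eq_add_neg] }
    (glueFun_strictMono c F).monotone
    (glueFun_strictMono (-c) fun m => (F (m - c))⁻¹).monotone

theorem glue_add (c : ℤ) (F : ℤ → (Icc (0 : ℝ) 1 ≃o Icc (0 : ℝ) 1)) (m : ℤ)
    (x : Icc (0 : ℝ) 1) : glue c F (m + x) = m + c + F m x := glueFun_add c F m x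

theorem glue_mul (c c' : ℤ) (F F' : ℤ → (Icc (0 : ℝ) 1 ≃o Icc (0 : ℝ) 1)) :
    glue c F * glue c' F' = glue (c + c') (fun m => F (m + c') * F' m) := by
  ext t; exact glueFun_comp c c' F F' t

theorem glue_one : glue 0 1 = 1 := by
  ext t; exact glueFun_one t

theorem glue_inv (c : ℤ) (F : ℤ → (Icc (0 : ℝ) 1 ≃o Icc (0 : ℝ) 1)) :
    (glue c F)⁻¹ = glue (-c) fun m => (F (m - c))⁻¹ := by
  ext t; rfl

/-- The homeomorphisms preserving all the unit cells. -/
def glueHom : (ℤ → (Icc (0 : ℝ) 1 ≃o Icc (0 : ℝ) 1)) →* (ℝ ≃o ℝ) where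
  toFun F := glue 0 F
  map_one' := glue_one
  map_mul' F F' := by rw [glue_mul]; simp; rfl

theorem glue_injective {c : ℤ} {F F' : ℤ → (Icc (0 : ℝ) 1 ≃o Icc (0 : ℝ) 1)}
    (h : glue c F = glue c F') : F = F' := by
  ext m x
  have := DFunLike.congr_fun h ((m : ℝ) + x)
  rw [glue_add, glue_add] at this
  linarith

/-- The function `m + x ↦ q m x`, for `m : ℤ` and `x ∈ [0,1)`. -/
def cells (q : ℤ → Icc (0 : ℝ) 1 → ℝ) (t : ℝ) : ℝ :=
  q ⌊t⌋ ⟨Int.fract t, Int.fract_nonneg t, (Int.fract_lt_one t).le⟩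

theorem cells_add {q : ℤ → Icc (0 : ℝ) 1 → ℝ} (h0 : ∀ m, q m 0 = 0) (h1 : ∀ m, q m 1 = 0) (m : ℤ)
    (x : Icc (0 : ℝ) 1) : cells q (m + x) = q m x := by
  rcases lt_or_eq_of_le x.2.2 with hx | hx
  · simp only [cells, floor_int_add hx, fract_int_add hx]
  · have hx1 : x = 1 := Subtype.ext hx
    subst hx1
    have h2 : (m : ℝ) + ((1 : Icc (0 : ℝ) 1) : ℝ) = ((m + 1 : ℤ) : ℝ) + ((0 : Icc (0 : ℝ) 1) : ℝ) := by
      push_cast; simp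
    rw [h2, h1]
    have h3 : ((0 : Icc (0 : ℝ) 1) : ℝ) < 1 := zero_lt_one
    simp only [cells, floor_int_add h3, fract_int_add h3]
    exact h0 _

theorem continuous_cells {q : ℤ → Icc (0 : ℝ) 1 → ℝ} (hq : ∀ m, Continuous (q m))
    (h0 : ∀ m, q m 0 = 0) (h1 : ∀ m, q m 1 = 0) : Continuous (cells q) := by
  have key : ∀ m : ℤ, ContinuousOn (cells q) (Icc (m : ℝ) (m + 1)) := by
    intro m
    have h2 : Continuous fun t : ℝ => q m (projIcc 0 1 zero_le_one (t - m)) :=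
      (hq m).comp (continuous_projIcc.comp (continuous_id.sub continuous_const))
    refine h2.continuousOn.congr fun t ht => ?_
    have h3 : t - m ∈ Icc (0 : ℝ) 1 := ⟨by linarith [ht.1], by linarith [ht.2]⟩
    dsimp only
    rw [projIcc_of_mem _ h3, ← cells_add h0 h1]
    simp
  rw [continuous_iff_continuousAt]
  intro t
  rw [continuousAt_iff_continuous_left_right]
  constructor
  · have h2 : ((⌈t⌉ - 1 : ℤ) : ℝ) < t := by push_cast; linarith [Int.ceil_lt_add_one t]
    have h3 : t ≤ ((⌈t⌉ - 1 : ℤ) : ℝ) + 1 := by push_cast; linarith [Int.le_ceil t]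
    refine ((key (⌈t⌉ - 1)) t ⟨h2.le, h3⟩).mono_of_mem_nhdsWithin ?_
    exact mem_of_superset (Ioc_mem_nhdsLE h2) (fun s hs => ⟨hs.1.le, hs.2.trans h3⟩)
  · have h2 := Int.floor_le t
    have h3 := Int.lt_floor_add_one t
    refine ((key ⌊t⌋) t ⟨h2, h3.le⟩).mono_of_mem_nhdsWithin ?_
    exact mem_of_superset (Ico_mem_nhdsGE h3) (fun s hs => ⟨h2.trans hs.1, hs.2.le⟩)

/-- The derivative of `glue c F` off the integers. -/
theorem hasDerivAt_glue {c : ℤ} {F : ℤ → (Icc (0 : ℝ) 1 ≃o Icc (0 : ℝ) 1)}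
    {u : ℤ → Icc (0 : ℝ) 1 → ℝ} (hu : ∀ m, HasLogDeriv (F m) (u m)) {t : ℝ}
    (ht : t ∉ range ((↑) : ℤ → ℝ)) : HasDerivAt (glue c F) (Real.exp (cells u t)) t := by
  obtain ⟨m, x, hx, rfl⟩ := exists_int_add t
  have hx0 : (0 : ℝ) < x := by
    refine lt_of_le_of_ne x.2.1 fun h => ht ⟨m, ?_⟩
    rw [← h]; simp
  have h1 : cells u (m + x) = u m x := by
    simp only [cells, floor_int_add hx, fract_int_add hx]
  rw [h1]
  have h2 : HasDerivAt (toFun (F m)) (Real.exp (u m x)) ((m : ℝ) + x - m) := by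
    rw [add_sub_cancel_left]
    exact ((hu m).2 x).hasDerivAt (Icc_mem_nhds hx0 hx)
  have h3 : HasDerivAt (fun t : ℝ => (m : ℝ) + c + toFun (F m) (t - m)) (Real.exp (u m x)) (m + x) := by
    have := (h2.comp ((m : ℝ) + x) ((hasDerivAt_id _).sub_const (m : ℝ))).const_add ((m : ℝ) + c)
    simpa using this
  refine h3.congr_of_eventuallyEq ?_
  filter_upwards [Ioo_mem_nhds (show (m : ℝ) < m + x by linarith)
    (show (m : ℝ) + x < m + 1 by linarith)] with s hs
  have h4 : s - m ∈ Icc (0 : ℝ) 1 := ⟨by linarith [hs.1], by linarith [hs.2]⟩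
  rw [toFun_of_mem _ h4, ← glue_add]
  simp

theorem glue_notMem_range_int (c : ℤ) (F : ℤ → (Icc (0 : ℝ) 1 ≃o Icc (0 : ℝ) 1)) {t : ℝ}
    (ht : t ∉ range ((↑) : ℤ → ℝ)) : glue c F t ∉ range ((↑) : ℤ → ℝ) := by
  rintro ⟨n, hn⟩
  apply ht
  refine ⟨n - c, (glue c F).injective ?_⟩
  have := glue_add c F (n - c) 0
  rw [orderIso_zero] at this
  rw [← hn]
  push_cast at this ⊢
  simpa using this

/-- Bounded displacement, uniform in `F`, is what makes the coboundary of a slowly varying function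
small. -/
theorem abs_glue_sub_le (c : ℤ) (F : ℤ → (Icc (0 : ℝ) 1 ≃o Icc (0 : ℝ) 1)) (t : ℝ) :
    |glue c F t - t| ≤ |(c : ℝ)| + 1 := by
  obtain ⟨m, x, hx, rfl⟩ := exists_int_add t
  rw [glue_add]
  have h1 : |(F m x : ℝ) - x| ≤ 1 := by
    rw [abs_le]; exact ⟨by linarith [(F m x).2.1, x.2.2], by linarith [(F m x).2.2, x.2.1]⟩
  calc |(m : ℝ) + c + F m x - (m + x)| = |(c : ℝ) + (F m x - x)| := by ring_nf
    _ ≤ _ := (abs_add_le _ _).trans (by linarith)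

/-! ### A chart of the unit interval -/

theorem unitInterval_param_mem (t : ℝ) :
    (1 + (orderIsoIooNegOneOne ℝ t : ℝ)) / 2 ∈ Icc (0 : ℝ) 1 :=
  ⟨by linarith [(orderIsoIooNegOneOne ℝ t).2.1], by linarith [(orderIsoIooNegOneOne ℝ t).2.2]⟩

/-- The chart `t ↦ (1 + t / (1 + |t|)) / 2` of the unit interval. -/
def unitChart : Chart (Icc (0 : ℝ) 1) where
  X t := ⟨(1 + (orderIsoIooNegOneOne ℝ t : ℝ)) / 2, unitInterval_param_mem t⟩
  strictMono := fun s t h => by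
    have : (orderIsoIooNegOneOne ℝ s : ℝ) < orderIsoIooNegOneOne ℝ t :=
      (orderIsoIooNegOneOne ℝ).strictMono h
    exact show (1 + (orderIsoIooNegOneOne ℝ s : ℝ)) / 2 < _ by linarith
  cover := fun s => by
    rcases s.2.1.eq_or_lt with h0 | h0
    · refine Or.inr (Or.inl fun t => ?_)
      change (s : ℝ) < (1 + (orderIsoIooNegOneOne ℝ t : ℝ)) / 2
      linarith [(orderIsoIooNegOneOne ℝ t).2.1]
    · rcases s.2.2.eq_or_lt with h1 | h1
      · refine Or.inr (Or.inr fun t => ?_)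
        change (1 + (orderIsoIooNegOneOne ℝ t : ℝ)) / 2 < (s : ℝ)
        linarith [(orderIsoIooNegOneOne ℝ t).2.2]
      · refine Or.inl ⟨(orderIsoIooNegOneOne ℝ).symm
          ⟨2 * s - 1, by constructor <;> linarith⟩, Subtype.ext ?_⟩
        simp

theorem unitChart_pos (t : ℝ) : 0 < unitChart.X t := by
  change (0 : ℝ) < (1 + (orderIsoIooNegOneOne ℝ t : ℝ)) / 2
  linarith [(orderIsoIooNegOneOne ℝ t).2.1]

theorem unitChart_lt_one (t : ℝ) : unitChart.X t < 1 := by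
  change (1 + (orderIsoIooNegOneOne ℝ t : ℝ)) / 2 < (1 : ℝ)
  linarith [(orderIsoIooNegOneOne ℝ t).2.2]

theorem zero_notMem_range_unitChart : (0 : Icc (0 : ℝ) 1) ∉ range unitChart.X :=
  fun ⟨t, h⟩ => (unitChart_pos t).ne' h

theorem one_notMem_range_unitChart : (1 : Icc (0 : ℝ) 1) ∉ range unitChart.X :=
  fun ⟨t, h⟩ => (unitChart_lt_one t).ne h

theorem mem_range_unitChart (s : Icc (0 : ℝ) 1) : s = 0 ∨ s = 1 ∨ s ∈ range unitChart.X := by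
  rcases unitChart.cover s with h | h | h
  · exact Or.inr (Or.inr h)
  · left
    by_contra h0
    have h1 : (0 : ℝ) < s := lt_of_le_of_ne s.2.1 fun h => h0 (Subtype.ext h.symm)
    have h2 : (s : ℝ) < 1 := (h 0).trans (unitChart_lt_one 0)
    have h3 := h ((orderIsoIooNegOneOne ℝ).symm ⟨2 * s - 1, by constructor <;> linarith⟩)
    refine h3.ne (Subtype.ext ?_)
    simp [unitChart]
  · right; left
    by_contra h0
    have h1 : (s : ℝ) < 1 := lt_of_le_of_ne s.2.2 fun h => h0 (Subtype.ext h)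
    have h2 : (0 : ℝ) < s := (unitChart_pos 0).trans (h 0)
    have h3 := h ((orderIsoIooNegOneOne ℝ).symm ⟨2 * s - 1, by constructor <;> linarith⟩)
    refine h3.ne (Subtype.ext ?_)
    simp [unitChart]

theorem mem_range_unitChart_of_mem_Ioo {a b s : Icc (0 : ℝ) 1} (hs : s ∈ Ioo a b) :
    s ∈ range unitChart.X := by
  rcases mem_range_unitChart s with rfl | rfl | h
  · exact absurd hs.1 (not_lt.2 a.2.1)
  · exact absurd hs.2 (not_lt.2 b.2.2)
  · exact h

theorem exists_unitChart_int_lt {s : Icc (0 : ℝ) 1} (hs : 0 < s) : ∃ m : ℤ, unitChart.X m < s := by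
  rcases mem_range_unitChart s with rfl | rfl | ⟨t, rfl⟩
  · exact absurd hs (lt_irrefl _)
  · exact ⟨0, unitChart_lt_one _⟩
  · refine ⟨⌊t⌋ - 1, unitChart.strictMono ?_⟩
    push_cast; linarith [Int.floor_le t]

theorem exists_lt_unitChart_int {s : Icc (0 : ℝ) 1} (hs : s < 1) : ∃ m : ℤ, s < unitChart.X m := by
  rcases mem_range_unitChart s with rfl | rfl | ⟨t, rfl⟩
  · exact ⟨0, unitChart_pos _⟩
  · exact absurd hs (lt_irrefl _)
  · refine ⟨⌊t⌋ + 1, unitChart.strictMono ?_⟩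
    push_cast; linarith [Int.lt_floor_add_one t]

/-! ### Total rationality -/

theorem mem_stab_iff {G : Subgroup (Icc (0 : ℝ) 1 ≃o Icc (0 : ℝ) 1)} {a b : Icc (0 : ℝ) 1}
    (hab : a ≤ b) {g : Icc (0 : ℝ) 1 ≃o Icc (0 : ℝ) 1} :
    g ∈ stab G a b ↔ g ∈ G ∧ g a = a ∧ g b = b := by
  have : g ∈ stab G a b ↔ g ∈ G ∧ g '' Icc a b = Icc a b := Iff.rfl
  rw [this, OrderIso.image_Icc]
  refine and_congr_right fun _ => ⟨fun h => ?_, fun h => by rw [h.1, h.2]⟩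
  have h1 := (Icc_subset_Icc_iff (g.monotone hab)).1 h.le
  have h2 := (Icc_subset_Icc_iff hab).1 h.ge
  exact ⟨le_antisymm h2.1 h1.1, le_antisymm h1.2 h2.2⟩

/-- A set meets a pair of distinct points in exactly one point when it separates them. In this form
linking depends only on order relations between the points, and is easily transported. -/
theorem not_linked_iff {a b c d : Icc (0 : ℝ) 1} (hab : a ≠ b) (hcd : c ≠ d) :
    ¬ Linked a b c d ↔ (c ∈ Ioo a b ↔ d ∈ Ioo a b) ∧ (a ∈ Ioo c d ↔ b ∈ Ioo c d) := by
  have key : ∀ (s : Set (Icc (0 : ℝ) 1)) (c d : Icc (0 : ℝ) 1), c ≠ d →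
      ((∃ x, s ∩ {c, d} = {x}) ↔ ¬ (c ∈ s ↔ d ∈ s)) := by
    intro s c d hcd
    constructor
    · rintro ⟨x, hx⟩ h
      have hxs : x ∈ s ∩ {c, d} := by rw [hx]; rfl
      have hc : c ∈ s := by
        rcases hxs.2 with rfl | rfl
        · exact hxs.1
        · exact h.2 hxs.1
      have h1 : c ∈ s ∩ {c, d} := ⟨hc, by simp⟩
      have h2 : d ∈ s ∩ {c, d} := ⟨h.1 hc, by simp⟩
      rw [hx] at h1 h2
      exact hcd (h1.trans h2.symm)
    · intro h
      by_cases hc : c ∈ s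
      · have hd : d ∉ s := fun hd => h ⟨fun _ => hd, fun _ => hc⟩
        refine ⟨c, ?_⟩
        ext x
        simp only [mem_inter_iff, mem_insert_iff, mem_singleton_iff]
        constructor
        · rintro ⟨hx, rfl | rfl⟩
          · rfl
          · exact absurd hx hd
        · rintro rfl; exact ⟨hc, Or.inl rfl⟩
      · have hd : d ∈ s := by
          by_contra hd; exact h ⟨fun h => absurd h hc, fun h => absurd h hd⟩
        refine ⟨d, ?_⟩
        ext x
        simp only [mem_inter_iff, mem_insert_iff, mem_singleton_iff]
        constructor
        · rintro ⟨hx, rfl | rfl⟩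
          · exact absurd hx hc
          · rfl
        · rintro rfl; exact ⟨hd, Or.inr rfl⟩
  rw [Linked, not_or, key _ _ _ hcd, key _ _ _ hab, not_not, not_not]

/-- Total rationality, with relative translation numbers given by integer valued functions. -/
def IntegrallyRational (G : Subgroup (Icc (0 : ℝ) 1 ≃o Icc (0 : ℝ) 1)) : Prop :=
  WithoutLinkedFixedPoints G ∧
  ∀ a b, IsSuccessivePair G a b → ∃ T : (Icc (0 : ℝ) 1 ≃o Icc (0 : ℝ) 1) → ℤ,
    (∀ g ∈ stab G a b, ∀ h ∈ stab G a b, T (g * h) = T g + T h) ∧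
    ∀ g ∈ stab G a b, (T g = 0 ↔ ∃ x ∈ Ioo a b, g x = x) ∧ (0 < T g ↔ ∀ x ∈ Ioo a b, x < g x)

theorem IsSuccessivePair.mono {G G' : Subgroup (Icc (0 : ℝ) 1 ≃o Icc (0 : ℝ) 1)} (h : G ≤ G')
    {a b : Icc (0 : ℝ) 1} (hab : IsSuccessivePair G a b) : IsSuccessivePair G' a b := by
  obtain ⟨h1, g, hg, h2⟩ := hab
  exact ⟨h1, g, h hg, h2⟩

/-- A smaller group has fewer successive pairs and smaller stabilizers. It is therefore enough to
treat the large groups `cellGroup`, without describing the group generated by given elements. -/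
theorem IntegrallyRational.mono {G G' : Subgroup (Icc (0 : ℝ) 1 ≃o Icc (0 : ℝ) 1)} (h : G ≤ G')
    (hG : IntegrallyRational G') : IntegrallyRational G := by
  refine ⟨fun a b c d hab hcd => hG.1 a b c d (hab.mono h) (hcd.mono h), fun a b hab => ?_⟩
  obtain ⟨T, hT1, hT2⟩ := hG.2 a b (hab.mono h)
  have hs : ∀ g ∈ stab G a b, g ∈ stab G' a b := fun g hg => ⟨h hg.1, hg.2⟩
  exact ⟨T, fun g hg k hk => hT1 g (hs g hg) k (hs k hk), fun g hg => hT2 g (hs g hg)⟩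

theorem IntegrallyRational.totallyRational {G : Subgroup (Icc (0 : ℝ) 1 ≃o Icc (0 : ℝ) 1)}
    (hG : IntegrallyRational G) : TotallyRational G := by
  refine ⟨hG.1, fun a b hab => ?_⟩
  obtain ⟨T, hT1, hT2⟩ := hG.2 a b hab
  let τ : stab G a b →* Multiplicative ℝ :=
    MonoidHom.mk' (fun g => Multiplicative.ofAdd (T g.1 : ℝ)) fun g h => by
      rw [← ofAdd_add]
      congr 1
      rw [← Int.cast_add, ← hT1 g.1 g.2 h.1 h.2]; rfl
  refine ⟨τ, ⟨fun g => ?_, fun g => ?_⟩, ?_⟩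
  · rw [← (hT2 g.1 g.2).1]
    change Multiplicative.ofAdd (T g.1 : ℝ) = 1 ↔ _
    rw [ofAdd_eq_one, Int.cast_eq_zero]
  · rw [← (hT2 g.1 g.2).2]
    change 0 < (T g.1 : ℝ) ↔ _
    rw [Int.cast_pos]
  -- The image lies in `ℤ ⊆ ℝ`, and subgroups of a cyclic group are cyclic.
  · refine Subgroup.isCyclic_of_le (H' := Subgroup.zpowers (Multiplicative.ofAdd (1 : ℝ))) ?_
    rintro _ ⟨g, rfl⟩
    refine ⟨T g.1, ?_⟩
    change Multiplicative.ofAdd (1 : ℝ) ^ (T g.1) = Multiplicative.ofAdd (T g.1 : ℝ)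
    rw [← ofAdd_zsmul]; simp

theorem integrallyRational_bot :
    IntegrallyRational (⊥ : Subgroup (Icc (0 : ℝ) 1 ≃o Icc (0 : ℝ) 1)) := by
  have h : ∀ a b, ¬ IsSuccessivePair (⊥ : Subgroup (Icc (0 : ℝ) 1 ≃o Icc (0 : ℝ) 1)) a b := by
    rintro a b ⟨hab, g, hg, -, -, hx⟩
    obtain ⟨x, hx'⟩ := exists_between hab
    rw [Subgroup.mem_bot] at hg
    subst hg
    exact hx x hx' rfl
  exact ⟨fun a b c d hab => absurd hab (h a b), fun a b hab => absurd hab (h a b)⟩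

theorem IntegrallyRational.conj {G : Subgroup (Icc (0 : ℝ) 1 ≃o Icc (0 : ℝ) 1)}
    (hG : IntegrallyRational G) (h : Icc (0 : ℝ) 1 ≃o Icc (0 : ℝ) 1) :
    IntegrallyRational (G.map (MulAut.conj h).toMonoidHom) := by
  have hmem : ∀ g, g ∈ G.map (MulAut.conj h).toMonoidHom ↔ h⁻¹ * g * h ∈ G := by
    intro g
    constructor
    · rintro ⟨k, hk, rfl⟩
      have : h⁻¹ * (h * k * h⁻¹) * h = k := by group
      simpa [this] using hk
    · intro hg
      exact ⟨_, hg, by simp [mul_assoc]⟩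
  have hiff : ∀ x y, h⁻¹ x < y ↔ x < h y := fun x y => by
    rw [← h.lt_iff_lt, ← RelIso.mul_apply, mul_inv_cancel, RelIso.one_apply]
  have hiff' : ∀ x y, y < h⁻¹ x ↔ h y < x := fun x y => by
    rw [← h.lt_iff_lt, ← RelIso.mul_apply, mul_inv_cancel, RelIso.one_apply]
  have happ : ∀ (g : Icc (0 : ℝ) 1 ≃o Icc (0 : ℝ) 1) x, (h⁻¹ * g * h) x = h⁻¹ (g (h x)) :=
    fun g x => rfl
  have hfix : ∀ (g : Icc (0 : ℝ) 1 ≃o Icc (0 : ℝ) 1) x, (h⁻¹ * g * h) x = x ↔ g (h x) = h x := by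
    intro g x
    rw [happ, ← h.injective.eq_iff, ← RelIso.mul_apply, mul_inv_cancel, RelIso.one_apply]
  have hh : ∀ x, h (h⁻¹ x) = x := fun x => by
    rw [← RelIso.mul_apply, mul_inv_cancel, RelIso.one_apply]
  have hpair : ∀ a b, IsSuccessivePair (G.map (MulAut.conj h).toMonoidHom) a b →
      IsSuccessivePair G (h⁻¹ a) (h⁻¹ b) := by
    rintro a b ⟨hab, g, hg, ha, hb, hx⟩
    refine ⟨h⁻¹.strictMono hab, h⁻¹ * g * h, (hmem g).1 hg, ?_, ?_, ?_⟩
    · rw [hfix, hh, ha]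
    · rw [hfix, hh, hb]
    · intro x hxab
      rw [Ne, hfix]
      exact hx _ ⟨(hiff _ _).1 hxab.1, (hiff' _ _).1 hxab.2⟩
  refine ⟨fun a b c d hab hcd => ?_, fun a b hab => ?_⟩
  · have := hG.1 _ _ _ _ (hpair a b hab) (hpair c d hcd)
    rw [not_linked_iff (hpair a b hab).1.ne (hpair c d hcd).1.ne] at this
    rw [not_linked_iff hab.1.ne hcd.1.ne]
    simpa only [mem_Ioo, h⁻¹.lt_iff_lt] using this
  · obtain ⟨T, hT1, hT2⟩ := hG.2 _ _ (hpair a b hab)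
    have hst : ∀ g ∈ stab (G.map (MulAut.conj h).toMonoidHom) a b,
        h⁻¹ * g * h ∈ stab G (h⁻¹ a) (h⁻¹ b) := by
      intro g hg
      rw [mem_stab_iff hab.1.le] at hg
      rw [mem_stab_iff (hpair a b hab).1.le, hfix, hfix, hh, hh]
      exact ⟨(hmem g).1 hg.1, hg.2⟩
    refine ⟨fun g => T (h⁻¹ * g * h), fun g hg k hk => ?_, fun g hg => ?_⟩
    · rw [← hT1 _ (hst g hg) _ (hst k hk)]
      group
    · obtain ⟨h1, h2⟩ := hT2 _ (hst g hg)
      dsimp only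
      rw [h1, h2]
      constructor
      · constructor
        · rintro ⟨x, hx, hgx⟩
          exact ⟨h x, ⟨(hiff _ _).1 hx.1, (hiff' _ _).1 hx.2⟩, (hfix _ _).1 hgx⟩
        · rintro ⟨x, hx, hgx⟩
          refine ⟨h⁻¹ x, ⟨h⁻¹.strictMono hx.1, h⁻¹.strictMono hx.2⟩, ?_⟩
          rw [hfix, hh, hgx]
      · constructor
        · intro H x hx
          have := H (h⁻¹ x) ⟨h⁻¹.strictMono hx.1, h⁻¹.strictMono hx.2⟩
          rwa [happ, hh, h⁻¹.lt_iff_lt] at this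
        · intro H x hx
          rw [happ, hiff']
          exact H _ ⟨(hiff _ _).1 hx.1, (hiff' _ _).1 hx.2⟩

/-! ### Groups acting on the unit cells -/

/-- The homeomorphisms of `[0,1]` that translate the unit cells of the chart by an element of `L`,
composed on each cell `m` with an element of `K m`. -/
def cellGroup (L : AddSubgroup ℤ) (K : ℤ → Subgroup (Icc (0 : ℝ) 1 ≃o Icc (0 : ℝ) 1))
    (hK : ∀ c ∈ L, ∀ m, K (m + c) = K m) : Subgroup (Icc (0 : ℝ) 1 ≃o Icc (0 : ℝ) 1) where
  carrier := {g | ∃ c ∈ L, ∃ F : ℤ → (Icc (0 : ℝ) 1 ≃o Icc (0 : ℝ) 1), (∀ m, F m ∈ K m) ∧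
    g = unitChart.ext (glue c F)}
  one_mem' := ⟨0, L.zero_mem, 1, fun m => (K m).one_mem, by rw [glue_one, map_one]⟩
  mul_mem' := by
    rintro _ _ ⟨c, hc, F, hF, rfl⟩ ⟨c', hc', F', hF', rfl⟩
    refine ⟨c + c', L.add_mem hc hc', _, fun m => ?_, by rw [← map_mul, glue_mul]⟩
    exact (K m).mul_mem (hK c' hc' m ▸ hF _) (hF' m)
  inv_mem' := by
    rintro _ ⟨c, hc, F, hF, rfl⟩
    refine ⟨-c, L.neg_mem hc, _, fun m => ?_, by rw [← map_inv, glue_inv]⟩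
    have := hK c hc (m - c)
    rw [sub_add_cancel] at this
    exact this ▸ (K _).inv_mem (hF (m - c))

theorem floor_glue (c : ℤ) (F : ℤ → (Icc (0 : ℝ) 1 ≃o Icc (0 : ℝ) 1)) (t : ℝ) :
    ⌊glue c F t⌋ = ⌊t⌋ + c := by
  obtain ⟨m, x, hx, rfl⟩ := exists_int_add t
  rw [glue_add, floor_int_add hx]
  have := floor_int_add (m := m + c) (orderIso_lt_one (f := F m) hx)
  rwa [Int.cast_add] at this

/-- The inclusion of the cell `m`. -/
def cellMap (m : ℤ) (x : Icc (0 : ℝ) 1) : Icc (0 : ℝ) 1 := unitChart.X (m + x)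

theorem cellMap_lt_iff {m : ℤ} {x y : Icc (0 : ℝ) 1} : cellMap m x < cellMap m y ↔ x < y := by
  rw [cellMap, cellMap, unitChart.strictMono.lt_iff_lt]; simp

theorem cellMap_injective (m : ℤ) : Function.Injective (cellMap m) := by
  intro x y h
  have := unitChart.strictMono.injective h
  exact Subtype.ext (by linarith)

theorem ext_glue_cellMap (c : ℤ) (F : ℤ → (Icc (0 : ℝ) 1 ≃o Icc (0 : ℝ) 1)) (m : ℤ)
    (x : Icc (0 : ℝ) 1) : unitChart.ext (glue c F) (cellMap m x) = cellMap (m + c) (F m x) := by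
  rw [cellMap, Chart.ext_X, glue_add, cellMap]; push_cast; rfl

/-- The points between two points of a cell belong to that cell. -/
theorem exists_cellMap_of_mem_Ioo {m : ℤ} {a b s : Icc (0 : ℝ) 1}
    (hs : s ∈ Ioo (cellMap m a) (cellMap m b)) : ∃ x ∈ Ioo a b, s = cellMap m x := by
  obtain ⟨t, rfl⟩ := mem_range_unitChart_of_mem_Ioo hs
  have h1 := unitChart.strictMono.lt_iff_lt.1 hs.1
  have h2 := unitChart.strictMono.lt_iff_lt.1 hs.2
  refine ⟨⟨t - m, by linarith [a.2.1], by linarith [b.2.2]⟩, ⟨?_, ?_⟩, ?_⟩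
  · exact show (a : ℝ) < t - m by linarith
  · exact show t - m < (b : ℝ) by linarith
  · simp [cellMap]

theorem glue_eq_of_fixed {c : ℤ} {F : ℤ → (Icc (0 : ℝ) 1 ≃o Icc (0 : ℝ) 1)} {s : Icc (0 : ℝ) 1}
    (hs : s ∈ range unitChart.X) (h : unitChart.ext (glue c F) s = s) : c = 0 := by
  obtain ⟨t, rfl⟩ := hs
  rw [Chart.ext_X] at h
  have := floor_glue c F t
  rw [unitChart.strictMono.injective h] at this
  omega

/-- An element translating the cells by `c ≠ 0` has no interior fixed point, which forces the pair
`{0,1}`. If `c = 0`, all the boundaries of cells are fixed; they accumulate at `0` and `1`, so a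
component of the complement of the fixed set is confined to a single cell and comes from the factor
acting there. -/
theorem isSuccessivePair_cellGroup {L : AddSubgroup ℤ}
    {K : ℤ → Subgroup (Icc (0 : ℝ) 1 ≃o Icc (0 : ℝ) 1)} {hK : ∀ c ∈ L, ∀ m, K (m + c) = K m}
    {a b : Icc (0 : ℝ) 1} (hab : IsSuccessivePair (cellGroup L K hK) a b) :
    (a = 0 ∧ b = 1) ∨ ∃ m a' b', IsSuccessivePair (K m) a' b' ∧ a = cellMap m a' ∧
      b = cellMap m b' := by
  obtain ⟨hlt, _, ⟨c, hc, F, hF, rfl⟩, ha, hb, hx⟩ := hab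
  by_cases hc0 : c = 0
  · subst hc0
    right
    have hint : ∀ m : ℤ, unitChart.X m ∉ Ioo a b := by
      intro m hm
      apply hx _ hm
      rw [Chart.ext_X]
      have := glue_add 0 F m 0
      rw [orderIso_zero] at this
      congr 1
      simpa using this
    have ha' : a ∈ range unitChart.X := by
      rcases mem_range_unitChart a with rfl | rfl | h
      · exfalso
        obtain ⟨m, hm⟩ := exists_unitChart_int_lt hlt
        exact hint m ⟨unitChart_pos _, hm⟩
      · exact absurd hlt (not_lt.2 b.2.2)
      · exact h
    have hb' : b ∈ range unitChart.X := by
      rcases mem_range_unitChart b with rfl | rfl | h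
      · exact absurd hlt (not_lt.2 a.2.1)
      · exfalso
        obtain ⟨m, hm⟩ := exists_lt_unitChart_int hlt
        exact hint m ⟨hm, unitChart_lt_one _⟩
      · exact h
    obtain ⟨s, rfl⟩ := ha'
    obtain ⟨t, rfl⟩ := hb'
    obtain ⟨m, x, hx1, rfl⟩ := exists_int_add s
    have hst := unitChart.strictMono.lt_iff_lt.1 hlt
    have ht : t ≤ m + 1 := by
      by_contra h
      refine hint (m + 1) ⟨unitChart.strictMono ?_, unitChart.strictMono ?_⟩
      · push_cast; linarith
      · push_cast; linarith
    obtain ⟨y, rfl⟩ : ∃ y : Icc (0 : ℝ) 1, t = m + y :=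
      ⟨⟨t - m, by linarith [x.2.1], by linarith⟩, by simp⟩
    have hxy : x < y := show (x : ℝ) < y by linarith
    refine ⟨m, x, y, ⟨hxy, F m, hF m, ?_, ?_, ?_⟩, rfl, rfl⟩
    · have := ext_glue_cellMap 0 F m x
      rw [cellMap, ha, add_zero] at this
      exact (cellMap_injective m this).symm
    · have := ext_glue_cellMap 0 F m y
      rw [cellMap, hb, add_zero] at this
      exact (cellMap_injective m this).symm
    · intro z hz hFz
      refine hx (cellMap m z) ⟨cellMap_lt_iff.2 hz.1, cellMap_lt_iff.2 hz.2⟩ ?_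
      rw [ext_glue_cellMap, hFz, add_zero]
  · left
    constructor
    · rcases mem_range_unitChart a with h | h | h
      · exact h
      · subst h; exact absurd hlt (not_lt.2 b.2.2)
      · exact absurd (glue_eq_of_fixed h ha) hc0
    · rcases mem_range_unitChart b with h | h | h
      · subst h; exact absurd hlt (not_lt.2 a.2.1)
      · exact h
      · exact absurd (glue_eq_of_fixed h hb) hc0

theorem cellMap_mem_Ioo_iff {m n : ℤ} {a b c : Icc (0 : ℝ) 1} (h : cellMap n c ∈ Ioo (cellMap m a) (cellMap m b)) :
    (m : ℝ) < n + c ∧ (n : ℝ) + c < m + 1 := by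
  have h1 := unitChart.strictMono.lt_iff_lt.1 h.1
  have h2 := unitChart.strictMono.lt_iff_lt.1 h.2
  exact ⟨by linarith [a.2.1], by linarith [b.2.2]⟩

theorem cellMap_notMem_Ioo {m n : ℤ} (hmn : m ≠ n) (a b c : Icc (0 : ℝ) 1) :
    cellMap n c ∉ Ioo (cellMap m a) (cellMap m b) := by
  intro h
  obtain ⟨h1, h2⟩ := cellMap_mem_Ioo_iff h
  have h3 : (m : ℝ) < n + 1 := by linarith [c.2.2]
  have h4 : (n : ℝ) < m + 1 := by linarith [c.2.1]
  norm_cast at h3 h4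
  omega

theorem cellMap_mem_Ioo_zero_one (m : ℤ) (x : Icc (0 : ℝ) 1) : cellMap m x ∈ Ioo 0 1 :=
  ⟨unitChart_pos _, unitChart_lt_one _⟩

/-- Pairs in distinct cells are disjoint and `{0,1}` encloses every other pair, so linking could
only occur inside one cell. The translation number on `[0,1]` is the number of cells translated,
read off from the image of a boundary of cells; on a smaller pair it is that of the cell. -/
theorem integrallyRational_cellGroup {L : AddSubgroup ℤ}
    {K : ℤ → Subgroup (Icc (0 : ℝ) 1 ≃o Icc (0 : ℝ) 1)} (hK : ∀ c ∈ L, ∀ m, K (m + c) = K m)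
    (hr : ∀ m, IntegrallyRational (K m)) : IntegrallyRational (cellGroup L K hK) := by
  refine ⟨fun a b c d hab hcd => ?_, fun a b hab => ?_⟩
  · rw [not_linked_iff hab.1.ne hcd.1.ne]
    have hz : ∀ a b : Icc (0 : ℝ) 1, (0 : Icc (0 : ℝ) 1) ∉ Ioo a b :=
      fun a b h => absurd h.1 (not_lt.2 a.2.1)
    have ho : ∀ a b : Icc (0 : ℝ) 1, (1 : Icc (0 : ℝ) 1) ∉ Ioo a b :=
      fun a b h => absurd h.2 (not_lt.2 b.2.2)
    rcases isSuccessivePair_cellGroup hab with ⟨rfl, rfl⟩ | ⟨m, a', b', hp, rfl, rfl⟩ <;>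
      rcases isSuccessivePair_cellGroup hcd with ⟨rfl, rfl⟩ | ⟨n, c', d', hq, rfl, rfl⟩
    · simp [hz, ho]
    · simp [hz, ho, cellMap_mem_Ioo_zero_one, -mem_Ioo]
    · simp [hz, ho, cellMap_mem_Ioo_zero_one, -mem_Ioo]
    · by_cases hmn : m = n
      · subst hmn
        have := (hr m).1 _ _ _ _ hp hq
        rw [not_linked_iff hp.1.ne hq.1.ne] at this
        simpa only [mem_Ioo, cellMap_lt_iff] using this
      · simp only [cellMap_notMem_Ioo hmn, cellMap_notMem_Ioo (Ne.symm hmn)]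
        simp
  · rcases isSuccessivePair_cellGroup hab with ⟨rfl, rfl⟩ | ⟨m, a', b', hp, rfl, rfl⟩
    · have hT : ∀ c F, ⌊unitChart.coord (unitChart.ext (glue c F) (unitChart.X 0))⌋ = c := by
        intro c F
        rw [Chart.ext_X, Chart.coord_X, floor_glue]; simp
      refine ⟨fun g => ⌊unitChart.coord (g (unitChart.X 0))⌋, ?_, ?_⟩
      · rintro _ ⟨⟨c, hc, F, hF, rfl⟩, -⟩ _ ⟨⟨c', hc', F', hF', rfl⟩, -⟩
        dsimp only
        rw [← map_mul, glue_mul, hT, hT, hT]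
      · rintro _ ⟨⟨c, hc, F, hF, rfl⟩, -⟩
        dsimp only
        rw [hT]
        constructor
        · constructor
          · rintro rfl
            refine ⟨cellMap 0 0, cellMap_mem_Ioo_zero_one _ _, ?_⟩
            rw [ext_glue_cellMap, orderIso_zero, add_zero]
          · rintro ⟨x, hx, h⟩
            exact glue_eq_of_fixed (mem_range_unitChart_of_mem_Ioo hx) h
        · constructor
          · intro hc x hx
            obtain ⟨t, rfl⟩ := mem_range_unitChart_of_mem_Ioo hx
            rw [Chart.ext_X]
            refine unitChart.strictMono ?_
            have h1 := floor_glue c F t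
            by_contra h2
            have := Int.floor_mono (not_lt.1 h2)
            omega
          · intro h
            have h1 := h (cellMap 0 0) (cellMap_mem_Ioo_zero_one _ _)
            rw [ext_glue_cellMap, orderIso_zero] at h1
            have := unitChart.strictMono.lt_iff_lt.1 h1
            simpa using this
    · obtain ⟨T, hT1, hT2⟩ := (hr m).2 a' b' hp
      have hst : ∀ g ∈ stab (cellGroup L K hK) (cellMap m a') (cellMap m b'),
          ∃ F, g = unitChart.ext (glue 0 F) ∧ F m ∈ stab (K m) a' b' := by
        intro g hg
        rw [mem_stab_iff hab.1.le] at hg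
        obtain ⟨⟨c, hc, F, hF, rfl⟩, h1, h2⟩ := hg
        obtain rfl := glue_eq_of_fixed ⟨_, rfl⟩ h1
        refine ⟨F, rfl, ?_⟩
        rw [ext_glue_cellMap, add_zero] at h1 h2
        rw [mem_stab_iff hp.1.le]
        exact ⟨hF m, cellMap_injective _ h1, cellMap_injective _ h2⟩
      classical
      -- `Φ` recovers the component of `g` in the cell `m`. The choice is harmless because `glue`
      -- and the chart action are injective; the default `1` is never met on the stabilizer.
      let Φ : (Icc (0 : ℝ) 1 ≃o Icc (0 : ℝ) 1) → (Icc (0 : ℝ) 1 ≃o Icc (0 : ℝ) 1) := fun g =>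
        if h : ∃ F, g = unitChart.ext (glue 0 F) then h.choose m else 1
      have hΦ : ∀ F, Φ (unitChart.ext (glue 0 F)) = F m := by
        intro F
        have h : ∃ F', unitChart.ext (glue 0 F) = unitChart.ext (glue 0 F') := ⟨F, rfl⟩
        have h1 : Φ (unitChart.ext (glue 0 F)) = h.choose m := dif_pos h
        rw [h1, ← glue_injective (unitChart.ext_injective h.choose_spec)]
      refine ⟨fun g => T (Φ g), fun g hg k hk => ?_, fun g hg => ?_⟩
      · obtain ⟨F, rfl, hF⟩ := hst g hg
        obtain ⟨F', rfl, hF'⟩ := hst k hk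
        dsimp only
        rw [← map_mul, glue_mul, add_zero, hΦ, hΦ, hΦ, add_zero, hT1 _ hF _ hF']
      · obtain ⟨F, rfl, hF⟩ := hst g hg
        dsimp only
        rw [hΦ, (hT2 _ hF).1, (hT2 _ hF).2]
        constructor
        · constructor
          · rintro ⟨x, hx, h⟩
            refine ⟨cellMap m x, ⟨cellMap_lt_iff.2 hx.1, cellMap_lt_iff.2 hx.2⟩, ?_⟩
            rw [ext_glue_cellMap, h, add_zero]
          · rintro ⟨s, hs, h⟩
            obtain ⟨x, hx, rfl⟩ := exists_cellMap_of_mem_Ioo hs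
            rw [ext_glue_cellMap, add_zero] at h
            exact ⟨x, hx, cellMap_injective _ h⟩
        · constructor
          · intro h s hs
            obtain ⟨x, hx, rfl⟩ := exists_cellMap_of_mem_Ioo hs
            rw [ext_glue_cellMap, add_zero, cellMap_lt_iff]
            exact h x hx
          · intro h x hx
            have := h (cellMap m x) ⟨cellMap_lt_iff.2 hx.1, cellMap_lt_iff.2 hx.2⟩
            rwa [ext_glue_cellMap, add_zero, cellMap_lt_iff] at this

/-! ### Closeness to the identity in terms of densities -/

/-- `g` has logarithmic derivative `u`, and the conjugates of `g` by the diffeomorphisms of densities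
proportional to `exp (ψ n)` have logarithmic derivatives that converge to `0`. -/
def CloseWith (ψ : ℕ → Icc (0 : ℝ) 1 → ℝ) (g : Icc (0 : ℝ) 1 ≃o Icc (0 : ℝ) 1)
    (u : Icc (0 : ℝ) 1 → ℝ) : Prop :=
  HasLogDeriv g u ∧ u 0 = 0 ∧ u 1 = 0 ∧
    ∀ ε > 0, ∀ᶠ n in atTop, ∀ x, |u x + ψ n (g x) - ψ n x| ≤ ε

/-- The group of the homeomorphisms that the densities `exp (ψ n)` bring close to the identity. -/
def closeGroup (ψ : ℕ → Icc (0 : ℝ) 1 → ℝ) : Subgroup (Icc (0 : ℝ) 1 ≃o Icc (0 : ℝ) 1) where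
  carrier := {g | ∃ u, CloseWith ψ g u}
  one_mem' := ⟨_, hasLogDeriv_one, rfl, rfl, fun ε hε => Eventually.of_forall fun n x => by
    simpa using hε.le⟩
  mul_mem' := by
    rintro f g ⟨u, hu, hu0, hu1, hu'⟩ ⟨v, hv, hv0, hv1, hv'⟩
    refine ⟨_, hu.mul hv, ?_, ?_, fun ε hε => ?_⟩
    · simp [orderIso_zero, hu0, hv0]
    · simp [orderIso_one, hu1, hv1]
    · filter_upwards [hu' (ε / 2) (by positivity), hv' (ε / 2) (by positivity)] with n h1 h2 x
      -- The corrected cocycle `u + ψ ∘ g - ψ` is again a cocycle: its value for `f * g` at `x` is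
      -- the sum of those of `f` at `g x` and of `g` at `x`.
      have := (abs_add_le _ _).trans (add_le_add (h1 (g x)) (h2 x))
      rw [add_halves] at this
      refine le_of_eq_of_le (congrArg abs ?_) this
      rw [RelIso.mul_apply]; ring
  inv_mem' := by
    rintro f ⟨u, hu, hu0, hu1, hu'⟩
    refine ⟨_, hu.inv, ?_, ?_, fun ε hε => ?_⟩
    · simp [orderIso_zero, hu0]
    · simp [orderIso_one, hu1]
    · filter_upwards [hu' ε hε] with n h1 x
      have := h1 (f⁻¹ x)
      rw [← RelIso.mul_apply, mul_inv_cancel, RelIso.one_apply, ← abs_neg] at this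
      convert this using 2
      ring

/-- A sequence of continuous functions that vanish at the end points. -/
def IsDensitySeq (ψ : ℕ → Icc (0 : ℝ) 1 → ℝ) : Prop :=
  ∀ n, Continuous (ψ n) ∧ ψ n 0 = 0 ∧ ψ n 1 = 0

/-- The constant `c` cancels in the conjugation. The conjugate has the `k`-th corrected cocycle of
`g` as logarithmic derivative, hence a small one for large `k`; subtracting `ψ k` from all the
densities keeps the later corrected cocycles unchanged. -/
theorem CloseWith.conj {ψ : ℕ → Icc (0 : ℝ) 1 → ℝ} {g : Icc (0 : ℝ) 1 ≃o Icc (0 : ℝ) 1}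
    {u : Icc (0 : ℝ) 1 → ℝ} (hg : CloseWith ψ g u) {k : ℕ} (h0 : ψ k 0 = 0) (h1 : ψ k 1 = 0)
    {h : Icc (0 : ℝ) 1 ≃o Icc (0 : ℝ) 1} {c : ℝ}
    (hh : HasLogDeriv h fun x => ψ k x - c) :
    CloseWith (fun n x => ψ n (h⁻¹ x) - ψ k (h⁻¹ x)) (h * g * h⁻¹)
      (fun x => u (h⁻¹ x) + ψ k (g (h⁻¹ x)) - ψ k (h⁻¹ x)) := by
  obtain ⟨hu, hu0, hu1, hu'⟩ := hg
  refine ⟨?_, ?_, ?_, fun ε hε => ?_⟩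
  · convert (hh.mul hu).mul hh.inv using 2
    ring
  · simp [orderIso_zero, hu0, h0]
  · simp [orderIso_one, hu1, h1]
  · filter_upwards [hu' ε hε] with n h2 x
    have := h2 (h⁻¹ x)
    convert this using 2
    have h3 : h⁻¹ ((h * g * h⁻¹) x) = g (h⁻¹ x) := by
      rw [← RelIso.mul_apply, ← RelIso.mul_apply]; congr 1; group
    rw [h3]; ring

/-! ### Slowly varying densities -/

theorem abs_log_sub_log_le {N a b : ℝ} (hN : 0 < N) (ha : N ≤ a) (hb : N ≤ b) :
    |Real.log a - Real.log b| ≤ |a - b| / N := by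
  have key : ∀ a b : ℝ, N ≤ a → N ≤ b → Real.log a - Real.log b ≤ |a - b| / N := by
    intro a b ha hb
    have ha' : 0 < a := hN.trans_le ha
    have hb' : 0 < b := hN.trans_le hb
    rw [← Real.log_div ha'.ne' hb'.ne']
    calc Real.log (a / b) ≤ a / b - 1 := Real.log_le_sub_one_of_pos (by positivity)
      _ = (a - b) / b := by field_simp
      _ ≤ |a - b| / b := by gcongr; exact le_abs_self _
      _ ≤ |a - b| / N := by gcongr
  rw [abs_le]
  constructor
  · have := key b a hb ha
    rw [abs_sub_comm] at this
    linarith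
  · exact key a b ha hb

/-- The function `t ↦ - 2 log (1 + |t|)`, cut off at the level `- 2 log N`. -/
def slowLog (N t : ℝ) : ℝ := -2 * Real.log (max (1 + |t|) N)

/-- The cut off alters the density only on a bounded set of coordinates, so `slowLog N - slowLog 1`
extends by `0` to the end points. -/
theorem slowLog_eq {N t : ℝ} (h : N ≤ 1 + |t|) : slowLog N t = slowLog 1 t := by
  rw [slowLog, slowLog, max_eq_left h, max_eq_left (by linarith [abs_nonneg t])]

theorem continuous_slowLog {N : ℝ} (hN : 0 < N) : Continuous (slowLog N) := by
  refine continuous_const.mul (Continuous.log ?_ fun t => (hN.trans_le (le_max_right _ _)).ne')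
  fun_prop

/-- The Lipschitz constant `2 / N` tends to `0` as the cut off is raised: maps of bounded
displacement then have a small coboundary on the whole line. -/
theorem abs_slowLog_sub_le {N : ℝ} (hN : 0 < N) (s t : ℝ) :
    |slowLog N s - slowLog N t| ≤ 2 * |s - t| / N := by
  have h1 := abs_log_sub_log_le hN (le_max_right (1 + |s|) N) (le_max_right (1 + |t|) N)
  have h2 : |max (1 + |s|) N - max (1 + |t|) N| ≤ |s - t| := by
    refine (abs_max_sub_max_le_abs _ _ _).trans ?_
    rw [add_sub_add_left_eq_sub]
    exact abs_abs_sub_abs_le s t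
  calc |slowLog N s - slowLog N t|
      = 2 * |Real.log (max (1 + |s|) N) - Real.log (max (1 + |t|) N)| := by
        rw [slowLog, slowLog, ← mul_sub, abs_mul]; norm_num
    _ ≤ 2 * (|s - t| / N) := by gcongr; exact h1.trans (by gcongr)
    _ = _ := by ring

theorem hasDerivAt_unitChart {t : ℝ} (ht : t ∉ range ((↑) : ℤ → ℝ)) :
    HasDerivAt (fun t => (unitChart.X t : ℝ)) (Real.exp (slowLog 1 t - Real.log 2)) t := by
  have ht0 : t ≠ 0 := fun h => ht ⟨0, by simp [h]⟩
  have habs : 0 < 1 + |t| := by positivity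
  have h1 : Real.exp (slowLog 1 t - Real.log 2) = 1 / (1 + |t|) ^ 2 / 2 := by
    rw [slowLog, max_eq_left (by linarith [abs_nonneg t]), Real.exp_sub, Real.exp_log two_pos,
      neg_mul, Real.exp_neg, two_mul, Real.exp_add, Real.exp_log habs]
    field_simp
  have h2 : (fun t => (unitChart.X t : ℝ)) = fun t => (1 + t / (1 + |t|)) / 2 := by
    ext t; simp [unitChart, orderIsoIooNegOneOne]; rfl
  rw [h1, h2]
  refine HasDerivAt.div_const (HasDerivAt.const_add _ ?_) _
  rcases lt_or_gt_of_ne ht0 with h | h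
  · rw [abs_of_neg h]
    have h3 : HasDerivAt (fun t : ℝ => t / (1 + -t)) (1 / (1 + -t) ^ 2) t := by
      have h4 : (1 + -t) ≠ 0 := by linarith
      refine ((hasDerivAt_id' t).div ((hasDerivAt_id' t).neg.const_add 1) h4).congr_deriv ?_
      congr 1; simp
    refine h3.congr_of_eventuallyEq ?_
    filter_upwards [gt_mem_nhds h] with s hs
    rw [abs_of_neg hs]
  · rw [abs_of_pos h]
    have h3 : HasDerivAt (fun t : ℝ => t / (1 + t)) (1 / (1 + t) ^ 2) t := by
      have h4 : (1 + t) ≠ 0 := by linarith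
      refine ((hasDerivAt_id' t).div ((hasDerivAt_id' t).const_add 1) h4).congr_deriv ?_
      congr 1; ring
    refine h3.congr_of_eventuallyEq ?_
    filter_upwards [lt_mem_nhds h] with s hs
    rw [abs_of_pos hs]

/-- A function of the line that is small far from the origin tends to `0` at both ends. -/
theorem tendsto_zero_atBot_atTop {V : ℝ → ℝ} (h : ∀ ε > 0, ∃ R : ℝ, ∀ t, R < |t| → |V t| ≤ ε) :
    Tendsto V atBot (𝓝 0) ∧ Tendsto V atTop (𝓝 0) := by
  have key : Tendsto V (comap (fun t : ℝ => |t|) atTop) (𝓝 0) := by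
    rw [Metric.tendsto_nhds]
    intro ε hε
    obtain ⟨R, hR⟩ := h (ε / 2) (by positivity)
    have : ∀ᶠ t in comap (fun t : ℝ => |t|) atTop, R < |t| :=
      tendsto_comap.eventually (eventually_gt_atTop R)
    filter_upwards [this] with t ht
    rw [Real.dist_eq, sub_zero]
    linarith [hR t ht]
  exact ⟨key.mono_left (tendsto_iff_comap.1 tendsto_abs_atBot_atTop),
    key.mono_left (tendsto_iff_comap.1 tendsto_abs_atTop_atTop)⟩

theorem abs_int_add_le (m : ℤ) (x : Icc (0 : ℝ) 1) : |(m : ℝ) + x| ≤ |(m : ℝ)| + 1 :=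
  (abs_add_le _ _).trans (by rw [abs_of_nonneg x.2.1]; linarith [x.2.2])

theorem continuous_lift_unitChart {V : ℝ → ℝ} (hV : Continuous V)
    (h : ∀ ε > 0, ∃ R : ℝ, ∀ t, R < |t| → |V t| ≤ ε) : Continuous (unitChart.lift V) :=
  unitChart.continuous_lift hV (fun _ _ => (tendsto_zero_atBot_atTop h).1)
    (fun _ _ => (tendsto_zero_atBot_atTop h).2)

theorem abs_slowLog_glue_sub_le {N : ℝ} (hN : 0 < N) (c : ℤ)
    (F : ℤ → (Icc (0 : ℝ) 1 ≃o Icc (0 : ℝ) 1)) (t : ℝ) :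
    |slowLog N (glue c F t) - slowLog N t| ≤ 2 * (|(c : ℝ)| + 1) / N :=
  (abs_slowLog_sub_le hN _ _).trans (by gcongr; exact abs_glue_sub_le c F t)

theorem unitChart_compl_range_countable : (range unitChart.X)ᶜ.Countable := by
  refine Set.Countable.mono (s₂ := {0, 1}) (fun s hs => ?_) (by simp)
  rcases mem_range_unitChart s with h | h | h
  · exact Or.inl h
  · exact Or.inr h
  · exact absurd h hs

/-- The derivative tends to `1` at both ends: the coboundary of `slowLog 1` decays because
displacements are bounded, and `hlim` makes the contribution of the far cells small. -/
theorem hasLogDeriv_ext_glue (c : ℤ) {F : ℤ → (Icc (0 : ℝ) 1 ≃o Icc (0 : ℝ) 1)}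
    {u : ℤ → Icc (0 : ℝ) 1 → ℝ} (hu : ∀ m, HasLogDeriv (F m) (u m)) (h0 : ∀ m, u m 0 = 0)
    (h1 : ∀ m, u m 1 = 0) (hlim : ∀ ε > 0, ∃ R : ℝ, ∀ m : ℤ, R < |(m : ℝ)| → ∀ x, |u m x| ≤ ε) :
    HasLogDeriv (unitChart.ext (glue c F))
      (unitChart.lift fun t => slowLog 1 (glue c F t) - slowLog 1 t + cells u t) := by
  have hcont : Continuous fun t => slowLog 1 (glue c F t) - slowLog 1 t + cells u t :=
    (((continuous_slowLog one_pos).comp (glue c F).continuous).sub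
      (continuous_slowLog one_pos)).add (continuous_cells (fun m => (hu m).1) h0 h1)
  refine unitChart.hasLogDeriv_ext isClosed_Icc unitChart_compl_range_countable
    (countable_range ((↑) : ℤ → ℝ)) (a := fun t => slowLog 1 t - Real.log 2) (b := cells u)
    (fun t => hasDerivAt_unitChart) (fun t => hasDerivAt_glue hu)
    (fun t => glue_notMem_range_int c F)
    (fun t => Icc_mem_nhds (unitChart_pos t) (unitChart_lt_one t)) ?_ ?_
  · refine continuous_lift_unitChart hcont fun ε hε => ?_
    obtain ⟨R, hR⟩ := hlim (ε / 2) (by positivity)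
    -- Chosen so that `2 * (|c| + 1) / N = ε / 2`. Beyond `N + |c| + 1` both `t` and its image are
    -- outside the range where the cut off at `N` has an effect.
    set N : ℝ := 4 * (|(c : ℝ)| + 1) / ε with hN
    have hNpos : 0 < N := by positivity
    refine ⟨max (R + 1) (N + |(c : ℝ)| + 1), fun t ht => ?_⟩
    have ht1 : R + 1 < |t| := (le_max_left _ _).trans_lt ht
    have ht2 : N + |(c : ℝ)| + 1 < |t| := (le_max_right _ _).trans_lt ht
    have h2 : |cells u t| ≤ ε / 2 := by
      obtain ⟨m, x, hx, rfl⟩ := exists_int_add t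
      rw [cells_add h0 h1]
      exact hR m (by linarith [abs_int_add_le m x]) x
    have h3 : |t| ≤ |glue c F t| + (|(c : ℝ)| + 1) := by
      have := abs_glue_sub_le c F t
      have h4 := abs_sub_abs_le_abs_sub t (glue c F t)
      rw [abs_sub_comm] at h4
      linarith
    have h5 := abs_slowLog_glue_sub_le hNpos c F t
    rw [slowLog_eq (by linarith [abs_nonneg (c : ℝ)]), slowLog_eq (N := N) (t := t)
      (by linarith [abs_nonneg (c : ℝ)])] at h5
    have h6 : 2 * (|(c : ℝ)| + 1) / N = ε / 2 := by
      rw [hN]; field_simp; ring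
    calc _ ≤ _ := abs_add_le _ _
      _ ≤ ε := by linarith
  · intro t _
    rw [Chart.lift_X]; ring

/-- The densities that flatten the chart of the unit interval, and are given by `q` in the cells. -/
def slowDensity (q : ℕ → ℤ → Icc (0 : ℝ) 1 → ℝ) (n : ℕ) : Icc (0 : ℝ) 1 → ℝ :=
  unitChart.lift fun t => slowLog (n + 1) t - slowLog 1 t + cells (q n) t

theorem isDensitySeq_slowDensity {q : ℕ → ℤ → Icc (0 : ℝ) 1 → ℝ} (hq : ∀ n m, Continuous (q n m))
    (h0 : ∀ n m, q n m 0 = 0) (h1 : ∀ n m, q n m 1 = 0)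
    (hfin : ∀ n, ∃ R : ℝ, ∀ m : ℤ, R < |(m : ℝ)| → ∀ x, q n m x = 0) :
    IsDensitySeq (slowDensity q) := by
  refine fun n => ⟨?_, unitChart.lift_of_notMem _ zero_notMem_range_unitChart,
    unitChart.lift_of_notMem _ one_notMem_range_unitChart⟩
  refine continuous_lift_unitChart (((continuous_slowLog (by positivity)).sub
    (continuous_slowLog one_pos)).add (continuous_cells (hq n) (h0 n) (h1 n))) fun ε hε => ?_
  obtain ⟨R, hR⟩ := hfin n
  refine ⟨max (R + 1) (n + 1), fun t ht => ?_⟩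
  have ht1 : R + 1 < |t| := (le_max_left _ _).trans_lt ht
  have ht2 : (n : ℝ) + 1 < |t| := (le_max_right _ _).trans_lt ht
  have h2 : cells (q n) t = 0 := by
    obtain ⟨m, x, hx, rfl⟩ := exists_int_add t
    rw [cells_add (h0 n) (h1 n)]
    exact hR m (by linarith [abs_int_add_le m x]) x
  rw [h2, slowLog_eq (by linarith), sub_self, add_zero, abs_zero]
  exact hε.le

/-- Adding `slowLog (n + 1) - slowLog 1` to the density replaces the coboundary of `slowLog 1` by
that of `slowLog (n + 1)`, of size at most `2 * (|c| + 1) / (n + 1)`. What remains is the condition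
`hq`, read cell by cell. -/
theorem ext_glue_mem_closeGroup (c : ℤ) {F : ℤ → (Icc (0 : ℝ) 1 ≃o Icc (0 : ℝ) 1)}
    {u : ℤ → Icc (0 : ℝ) 1 → ℝ} (hu : ∀ m, HasLogDeriv (F m) (u m)) (h0 : ∀ m, u m 0 = 0)
    (h1 : ∀ m, u m 1 = 0) (hlim : ∀ ε > 0, ∃ R : ℝ, ∀ m : ℤ, R < |(m : ℝ)| → ∀ x, |u m x| ≤ ε)
    {q : ℕ → ℤ → Icc (0 : ℝ) 1 → ℝ} (hq0 : ∀ n m, q n m 0 = 0) (hq1 : ∀ n m, q n m 1 = 0)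
    (hq : ∀ ε > 0, ∀ᶠ n in atTop, ∀ m x, |u m x + q n (m + c) (F m x) - q n m x| ≤ ε) :
    unitChart.ext (glue c F) ∈ closeGroup (slowDensity q) := by
  refine ⟨_, hasLogDeriv_ext_glue c hu h0 h1 hlim,
    unitChart.lift_of_notMem _ zero_notMem_range_unitChart,
    unitChart.lift_of_notMem _ one_notMem_range_unitChart, fun ε hε => ?_⟩
  have hlim : Tendsto (fun n : ℕ => 2 * (|(c : ℝ)| + 1) * (1 / ((n : ℝ) + 1))) atTop (𝓝 0) := by
    simpa using tendsto_one_div_add_atTop_nhds_zero_nat.const_mul (2 * (|(c : ℝ)| + 1))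
  filter_upwards [hq (ε / 2) (by positivity), hlim.eventually (gt_mem_nhds (half_pos hε))]
    with n hn hn' s
  by_cases hs : s ∈ range unitChart.X
  · obtain ⟨t, rfl⟩ := hs
    obtain ⟨m, x, hx, rfl⟩ := exists_int_add t
    have h2 := abs_slowLog_glue_sub_le (N := n + 1) (by positivity) c F (m + x)
    rw [div_eq_mul_one_div] at h2
    have h3 := hn m x
    have h4 : cells (q n) (glue c F (m + x)) = q n (m + c) (F m x) := by
      rw [glue_add]
      have := cells_add (hq0 n) (hq1 n) (m + c) (F m x)
      rwa [Int.cast_add] at this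
    rw [Chart.ext_X, Chart.lift_X, slowDensity, Chart.lift_X, Chart.lift_X, h4, cells_add h0 h1,
      cells_add (hq0 n) (hq1 n)]
    calc _ = |(slowLog (n + 1) (glue c F (m + x)) - slowLog (n + 1) (m + x)) +
          (u m x + q n (m + c) (F m x) - q n m x)| := by congr 1; ring
      _ ≤ _ := abs_add_le _ _
      _ ≤ ε := by linarith
  · rw [unitChart.ext_of_notMem _ hs, unitChart.lift_of_notMem _ hs]
    simpa using hε.le

theorem exists_bound {ψ : Icc (0 : ℝ) 1 → ℝ} (hψ : Continuous ψ) : ∃ B, 0 ≤ B ∧ ∀ x, |ψ x| ≤ B := by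
  obtain ⟨B, hB⟩ := isCompact_univ.exists_bound_of_continuousOn hψ.continuousOn
  exact ⟨B, (norm_nonneg _).trans (hB 0 (mem_univ _)), fun x => hB x (mem_univ _)⟩

/-- The wreath product with `ℤ` of a group that is close to the identity is close to the identity. -/
theorem exists_isDensitySeq_wreath {ψ : ℕ → Icc (0 : ℝ) 1 → ℝ} (hψ : IsDensitySeq ψ) :
    ∃ Ψ, IsDensitySeq Ψ ∧ unitChart.ext (glue 1 1) ∈ closeGroup Ψ ∧
      ∀ g ∈ closeGroup ψ, unitChart.ext (glue 0 (Pi.mulSingle 0 g)) ∈ closeGroup Ψ := by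
  choose B hB0 hB using fun n => exists_bound (hψ n).1
  -- The width of the tent `w n` is large compared with `B n`: passing to the next cell changes `w n
  -- m * ψ n` by at most `B n / M n ≤ 1 / (n + 1)`, which takes care of the translation. In the cell
  -- `0` the weight is `1`, so that the density there is exactly `ψ n`.
  set M : ℕ → ℝ := fun n => (n + 1) * (B n + 1) with hM
  have hMpos : ∀ n, 0 < M n := fun n => mul_pos (by positivity) (by linarith [hB0 n])
  set w : ℕ → ℤ → ℝ := fun n m => max 0 (1 - |(m : ℝ)| / M n) with hw
  have hw0 : ∀ n, w n 0 = 1 := fun n => by simp [hw]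
  have hwd : ∀ n m, |w n (m + 1) - w n m| ≤ 1 / M n := by
    intro n m
    have h1 : |(1 - |((m + 1 : ℤ) : ℝ)| / M n) - (1 - |(m : ℝ)| / M n)| ≤ 1 / M n := by
      have h2 : (1 - |((m + 1 : ℤ) : ℝ)| / M n) - (1 - |(m : ℝ)| / M n) =
          (|(m : ℝ)| - |(m : ℝ) + 1|) / M n := by push_cast; ring
      rw [h2, abs_div, abs_of_pos (hMpos n)]
      refine div_le_div_of_nonneg_right ?_ (hMpos n).le
      have := abs_abs_sub_abs_le (m : ℝ) (m + 1)
      simpa using this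
    refine le_trans ?_ h1
    simp only [hw, max_comm (0 : ℝ)]
    exact abs_max_sub_max_le_abs _ _ _
  set q : ℕ → ℤ → Icc (0 : ℝ) 1 → ℝ := fun n m x => w n m * ψ n x with hq
  have hq0 : ∀ n m, q n m 0 = 0 := fun n m => by simp [hq, (hψ n).2.1]
  have hq1 : ∀ n m, q n m 1 = 0 := fun n m => by simp [hq, (hψ n).2.2]
  refine ⟨slowDensity q, isDensitySeq_slowDensity
    (fun n m => continuous_const.mul (hψ n).1) hq0 hq1 ?_, ?_, ?_⟩
  · refine fun n => ⟨M n, fun m hm x => ?_⟩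
    have h1 : 1 < |(m : ℝ)| / M n := (one_lt_div (hMpos n)).2 hm
    have h2 : w n m = 0 := max_eq_left (by linarith)
    simp only [hq, h2, zero_mul]
  · refine ext_glue_mem_closeGroup 1 (u := fun _ _ => 0) (fun m => hasLogDeriv_one) (fun _ => rfl)
      (fun _ => rfl) (fun ε hε => ⟨0, fun m _ x => by simpa using hε.le⟩) hq0 hq1 fun ε hε => ?_
    filter_upwards [tendsto_one_div_add_atTop_nhds_zero_nat.eventually (gt_mem_nhds hε)]
      with n hn m x
    have h1 : (0 : ℝ) + q n (m + 1) x - q n m x = (w n (m + 1) - w n m) * ψ n x := by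
      simp only [hq]; ring
    have h2 : |(w n (m + 1) - w n m) * ψ n x| ≤ 1 / (n + 1) := by
      rw [abs_mul]
      calc _ ≤ 1 / M n * (B n + 1) := by
            refine mul_le_mul (hwd n m) ((hB n x).trans (by linarith)) (abs_nonneg _) ?_
            exact (one_div_pos.2 (hMpos n)).le
        _ = 1 / (n + 1) := by
            have : B n + 1 ≠ 0 := by linarith [hB0 n]
            rw [hM]; field_simp
    change |(0 : ℝ) + q n (m + 1) x - q n m x| ≤ ε
    rw [h1]
    exact h2.trans hn.le
  · rintro g ⟨u, hu, hu0, hu1, hu'⟩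
    have hcase : ∀ m : ℤ, m ≠ 0 → (Pi.mulSingle 0 g : ℤ → (Icc (0 : ℝ) 1 ≃o Icc (0 : ℝ) 1)) m = 1 :=
      fun m hm => by simp [Pi.mulSingle, hm]
    refine ext_glue_mem_closeGroup 0 (u := fun m x => if m = 0 then u x else 0) (fun m => ?_)
      (fun m => by simp [hu0]) (fun m => by simp [hu1]) (fun ε hε => ⟨0, fun m hm x => ?_⟩) hq0 hq1
      fun ε hε => ?_
    · by_cases hm : m = 0
      · subst hm; simpa using hu
      · simp only [hcase m hm, if_neg hm]; exact hasLogDeriv_one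
    · have : m ≠ 0 := by rintro rfl; simp at hm
      simpa [this] using hε.le
    · filter_upwards [hu' ε hε] with n hn m x
      by_cases hm : m = 0
      · subst hm
        simpa [hq, hw0] using hn x
      · simpa [hcase m hm, hm] using hε.le

/-- A union, over the unit cells, of homeomorphisms that are close to the identity. -/
theorem exists_isDensitySeq_union {ι : Type*} [Finite ι] {ψ : ℤ → ℕ → Icc (0 : ℝ) 1 → ℝ}
    (hψ : ∀ m, IsDensitySeq (ψ m)) {F : ι → ℤ → (Icc (0 : ℝ) 1 ≃o Icc (0 : ℝ) 1)}
    {u : ι → ℤ → Icc (0 : ℝ) 1 → ℝ} (hu : ∀ i m, CloseWith (ψ m) (F i m) (u i m))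
    (hsmall : ∀ i m x, |u i m x| ≤ 1 / (|(m : ℝ)| + 1)) :
    ∃ Ψ, IsDensitySeq Ψ ∧ ∀ i, unitChart.ext (glue 0 (F i)) ∈ closeGroup Ψ := by
  -- Each cell converges at its own speed, so the index `j` depends on the cell; finiteness of `ι`
  -- makes it common to all `i`.
  have hj : ∀ (n : ℕ) (m : ℤ), ∃ j, ∀ i x,
      |u i m x + ψ m j (F i m x) - ψ m j x| ≤ 1 / ((n : ℝ) + 1) := by
    intro n m
    have := eventually_all.2 fun i => (hu i m).2.2.2 (1 / ((n : ℝ) + 1)) (by positivity)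
    exact this.exists
  choose j hj using hj
  -- Only finitely many cells are corrected at stage `n`. In the others `hsmall` already bounds the
  -- logarithmic derivatives by `1 / (n + 1)`.
  set q : ℕ → ℤ → Icc (0 : ℝ) 1 → ℝ := fun n m x => if |(m : ℝ)| ≤ n then ψ m (j n m) x else 0
    with hq
  have hq0 : ∀ n m, q n m 0 = 0 := fun n m => by simp [hq, (hψ m _).2.1]
  have hq1 : ∀ n m, q n m 1 = 0 := fun n m => by simp [hq, (hψ m _).2.2]
  refine ⟨slowDensity q, isDensitySeq_slowDensity (fun n m => ?_) hq0 hq1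
    (fun n => ⟨n, fun m hm x => if_neg hm.not_ge⟩), fun i => ?_⟩
  · by_cases h : |(m : ℝ)| ≤ n
    · simp only [hq, if_pos h]; exact (hψ m _).1
    · simp only [hq, if_neg h]; exact continuous_const
  · refine ext_glue_mem_closeGroup 0 (fun m => (hu i m).1) (fun m => (hu i m).2.1)
      (fun m => (hu i m).2.2.1) (fun ε hε => ⟨1 / ε, fun m hm x => (hsmall i m x).trans ?_⟩) hq0 hq1
      fun ε hε => ?_
    · rw [div_le_iff₀ (by positivity)]
      rw [div_lt_iff₀ hε] at hm
      nlinarith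
    · filter_upwards [tendsto_one_div_add_atTop_nhds_zero_nat.eventually (gt_mem_nhds hε)]
        with n hn m x
      rw [add_zero]
      by_cases h : |(m : ℝ)| ≤ n
      · simp only [hq, if_pos h]
        exact (hj n m i x).trans hn.le
      · simp only [hq, if_neg h, add_zero, sub_zero]
        refine ((hsmall i m x).trans ?_).trans hn.le
        gcongr
        exact (not_le.1 h).le

/-! ### Iterated wreath products of infinite cyclic groups -/

/-- The shift of the first coordinate. -/
def shiftPerm (V : Type) : Equiv.Perm (ℤ × V) :=
  Equiv.prodCongr (Equiv.addRight 1) (Equiv.refl V)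

/-- The action of a permutation of `V` on `{0} × V`. -/
def placeHom (V : Type) : Equiv.Perm V →* Equiv.Perm (ℤ × V) where
  toFun g :=
    { toFun := fun p => (p.1, if p.1 = 0 then g p.2 else p.2)
      invFun := fun p => (p.1, if p.1 = 0 then g⁻¹ p.2 else p.2)
      left_inv := fun p => by obtain ⟨m, v⟩ := p; by_cases h : m = 0 <;> simp [h]
      right_inv := fun p => by obtain ⟨m, v⟩ := p; by_cases h : m = 0 <;> simp [h] }
  map_one' := by ext p <;> simp
  map_mul' f g := by
    ext p
    · simp
    · by_cases h : p.1 = 0 <;> simp [h]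

theorem shiftPerm_apply (V : Type) (m : ℤ) (v : V) : shiftPerm V (m, v) = (m + 1, v) := rfl

theorem placeHom_apply (V : Type) (g : Equiv.Perm V) (m : ℤ) (v : V) :
    placeHom V g (m, v) = (m, if m = 0 then g v else v) := rfl

theorem shiftPerm_zpow_apply (V : Type) (k m : ℤ) (v : V) :
    (shiftPerm V ^ k) (m, v) = (m + k, v) := by
  induction k using Int.induction_on with
  | zero => simp
  | succ k ih =>
    rw [add_comm, zpow_add, Equiv.Perm.mul_apply, ih, zpow_one, shiftPerm_apply]
    ext <;> simp; ring
  | pred k ih =>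
    rw [sub_eq_add_neg, add_comm, zpow_add, Equiv.Perm.mul_apply, ih, zpow_neg_one,
      Equiv.Perm.inv_eq_iff_eq, shiftPerm_apply]
    ext <;> simp; ring

/-- The restricted wreath product of a group of permutations with `ℤ`. -/
def wreathPerms {V : Type} (A : Subgroup (Equiv.Perm V)) : Subgroup (Equiv.Perm (ℤ × V)) :=
  Subgroup.closure (insert (shiftPerm V) (placeHom V '' A))

theorem shiftPerm_mem {V : Type} (A : Subgroup (Equiv.Perm V)) : shiftPerm V ∈ wreathPerms A :=
  Subgroup.subset_closure (mem_insert _ _)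

theorem placeHom_mem {V : Type} {A : Subgroup (Equiv.Perm V)} {g : Equiv.Perm V} (hg : g ∈ A) :
    placeHom V g ∈ wreathPerms A :=
  Subgroup.subset_closure (mem_insert_of_mem _ ⟨g, hg, rfl⟩)

/-- The groups of permutations contained in iterated wreath products of copies of `ℤ`. -/
inductive IteratedWreath : ∀ V : Type, Subgroup (Equiv.Perm V) → Prop
  | unit : IteratedWreath Unit ⊥
  | wreath {V : Type} {A : Subgroup (Equiv.Perm V)} (h : IteratedWreath V A) :
      IteratedWreath (ℤ × V) (wreathPerms A)
  | congr {V W : Type} {A : Subgroup (Equiv.Perm V)} {B : Subgroup (Equiv.Perm W)} (e : W ≃ V)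
      (h : IteratedWreath V A) (hAB : ∀ g ∈ B, e.permCongr g ∈ A) : IteratedWreath W B

/-- Permutations that preserve the last coordinate. -/
def deepHom (V : Type) : Equiv.Perm V →* Equiv.Perm (V × ℤ) where
  toFun g := Equiv.prodCongr g (Equiv.refl ℤ)
  map_one' := rfl
  map_mul' _ _ := rfl

/-- The translation by `1` of the last coordinate of the points above `v`. -/
def deepBump {V : Type} (v : V) : Equiv.Perm (V × ℤ) := by
  classical exact
    { toFun := fun p => (p.1, if p.1 = v then p.2 + 1 else p.2)
      invFun := fun p => (p.1, if p.1 = v then p.2 - 1 else p.2)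
      left_inv := fun p => by obtain ⟨w, n⟩ := p; by_cases h : w = v <;> simp [h]
      right_inv := fun p => by obtain ⟨w, n⟩ := p; by_cases h : w = v <;> simp [h] }

theorem deepHom_apply {V : Type} (g : Equiv.Perm V) (v : V) (n : ℤ) :
    deepHom V g (v, n) = (g v, n) := rfl

theorem deepBump_apply_self {V : Type} (v : V) (n : ℤ) : deepBump v (v, n) = (v, n + 1) := by
  simp [deepBump]

theorem deepBump_apply_of_ne {V : Type} {v w : V} (h : w ≠ v) (n : ℤ) :
    deepBump v (w, n) = (w, n) := by
  simp [deepBump, h]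

theorem permCongr_deepBump {V W : Type} (e : W ≃ V) (w : W) :
    (Equiv.prodCongr e (Equiv.refl ℤ)).permCongr (deepBump w) = deepBump (e w) := by
  ext1 ⟨v, n⟩
  obtain ⟨w', rfl⟩ := e.surjective v
  have h1 : (Equiv.prodCongr e (Equiv.refl ℤ)).symm (e w', n) = (w', n) := by simp
  rw [Equiv.permCongr_apply, h1]
  by_cases h : w' = w
  · subst h
    rw [deepBump_apply_self, deepBump_apply_self]; rfl
  · rw [deepBump_apply_of_ne h, deepBump_apply_of_ne (e.injective.ne h)]; rfl

theorem permCongr_deepHom_shiftPerm (V : Type) :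
    (Equiv.prodAssoc ℤ V ℤ).permCongr (deepHom (ℤ × V) (shiftPerm V)) = shiftPerm (V × ℤ) := rfl

theorem permCongr_deepHom_placeHom {V : Type} (g : Equiv.Perm V) :
    (Equiv.prodAssoc ℤ V ℤ).permCongr (deepHom (ℤ × V) (placeHom V g)) =
      placeHom (V × ℤ) (deepHom V g) := by
  ext1 ⟨m, v, n⟩
  have h1 : (Equiv.prodAssoc ℤ V ℤ).symm (m, v, n) = ((m, v), n) := rfl
  rw [Equiv.permCongr_apply, h1, deepHom_apply, placeHom_apply, placeHom_apply, deepHom_apply]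
  split_ifs <;> rfl

/-- The bump above `(m, v)` is the bump above `v` placed in the copy `0` and carried to the copy `m`
by the shift, hence it belongs to the wreath product. -/
theorem permCongr_prodAssoc_deepBump {V : Type} (m : ℤ) (v : V) :
    (Equiv.prodAssoc ℤ V ℤ).permCongr (deepBump (m, v)) =
      shiftPerm (V × ℤ) ^ m * placeHom (V × ℤ) (deepBump v) * shiftPerm (V × ℤ) ^ (-m) := by
  ext1 ⟨m', w, n⟩
  have h1 : (Equiv.prodAssoc ℤ V ℤ).symm (m', w, n) = ((m', w), n) := rfl
  rw [Equiv.permCongr_apply, h1, Equiv.Perm.mul_apply, Equiv.Perm.mul_apply, shiftPerm_zpow_apply,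
    placeHom_apply, shiftPerm_zpow_apply, neg_add_cancel_right]
  by_cases hm : m' = m
  · subst hm
    rw [if_pos (by ring)]
    by_cases hw : w = v
    · subst hw
      rw [deepBump_apply_self, deepBump_apply_self]; rfl
    · rw [deepBump_apply_of_ne hw, deepBump_apply_of_ne (fun h => hw (congrArg Prod.snd h))]; rfl
  · rw [if_neg (by omega), deepBump_apply_of_ne (fun h => hm (congrArg Prod.fst h))]; rfl

/-- A new last coordinate can be added to an iterated wreath product. -/
theorem IteratedWreath.deep {V : Type} {A : Subgroup (Equiv.Perm V)} (h : IteratedWreath V A) :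
    ∃ B, IteratedWreath (V × ℤ) B ∧ (∀ g ∈ A, deepHom V g ∈ B) ∧ ∀ v, deepBump v ∈ B := by
  induction h with
  | unit =>
    -- Above a single point the bump is the shift of `ℤ`. In the next case, associativity of the
    -- product moves the new coordinate, last in `(ℤ × V) × ℤ`, into the inner factor `V × ℤ`, where
    -- the induction hypothesis applies.
    refine ⟨(wreathPerms ⊥).comap (Equiv.prodComm Unit ℤ).permCongrHom.toMonoidHom,
      IteratedWreath.congr (Equiv.prodComm Unit ℤ) IteratedWreath.unit.wreath fun g hg => hg,
      fun g hg => ?_, fun v => ?_⟩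
    · obtain rfl : g = 1 := hg
      rw [map_one]; exact Subgroup.one_mem _
    · change (Equiv.prodComm Unit ℤ).permCongr (deepBump v) ∈ wreathPerms ⊥
      have : (Equiv.prodComm Unit ℤ).permCongr (deepBump v) = shiftPerm Unit := by
        ext1 ⟨n, w⟩
        have h1 : (Equiv.prodComm Unit ℤ).symm (n, w) = (w, n) := rfl
        rw [Equiv.permCongr_apply, h1, Subsingleton.elim w v, deepBump_apply_self]; rfl
      rw [this]; exact shiftPerm_mem _
  | @wreath V A h ih =>
    obtain ⟨B, hB, hA, hb⟩ := ih
    refine ⟨(wreathPerms B).comap (Equiv.prodAssoc ℤ V ℤ).permCongrHom.toMonoidHom,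
      IteratedWreath.congr (Equiv.prodAssoc ℤ V ℤ) hB.wreath fun g hg => hg, fun g hg => ?_,
      fun v => ?_⟩
    · have : wreathPerms A ≤ ((wreathPerms B).comap
          (Equiv.prodAssoc ℤ V ℤ).permCongrHom.toMonoidHom).comap (deepHom (ℤ × V)) := by
        rw [wreathPerms, Subgroup.closure_le]
        rintro _ (rfl | ⟨g, hg, rfl⟩)
        · change (Equiv.prodAssoc ℤ V ℤ).permCongr (deepHom (ℤ × V) (shiftPerm V)) ∈ wreathPerms B
          rw [permCongr_deepHom_shiftPerm]; exact shiftPerm_mem B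
        · change (Equiv.prodAssoc ℤ V ℤ).permCongr (deepHom (ℤ × V) (placeHom V g)) ∈ wreathPerms B
          rw [permCongr_deepHom_placeHom]; exact placeHom_mem (hA g hg)
      exact this hg
    · obtain ⟨m, v⟩ := v
      change (Equiv.prodAssoc ℤ V ℤ).permCongr (deepBump (m, v)) ∈ wreathPerms B
      rw [permCongr_prodAssoc_deepBump]
      exact Subgroup.mul_mem _ (Subgroup.mul_mem _ (Subgroup.zpow_mem _ (shiftPerm_mem _) _)
        (placeHom_mem (hb v))) (Subgroup.zpow_mem _ (shiftPerm_mem _) _)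
  | @congr V W A A' e h hAA' ih =>
    obtain ⟨B, hB, hA, hb⟩ := ih
    refine ⟨B.comap (Equiv.prodCongr e (Equiv.refl ℤ)).permCongrHom.toMonoidHom,
      IteratedWreath.congr (Equiv.prodCongr e (Equiv.refl ℤ)) hB fun g hg => hg, fun g hg => ?_,
      fun w => ?_⟩
    · exact hA _ (hAA' g hg)
    · change (Equiv.prodCongr e (Equiv.refl ℤ)).permCongr (deepBump w) ∈ B
      rw [permCongr_deepBump]; exact hb _

/-! ### Free groups are residually iterated wreath products of infinite cyclic groups -/

/-- The permutation given by a letter. -/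
def letterPerm {α V : Type} (s : α → Equiv.Perm V) (l : α × Bool) : Equiv.Perm V :=
  cond l.2 (s l.1) (s l.1)⁻¹

/-- The permutation given by a word. -/
def wordPerm {α V : Type} (s : α → Equiv.Perm V) (L : List (α × Bool)) : Equiv.Perm V :=
  (L.map (letterPerm s)).prod

theorem wordPerm_cons {α V : Type} (s : α → Equiv.Perm V) (l : α × Bool) (L : List (α × Bool))
    (v : V) : wordPerm s (l :: L) v = letterPerm s l (wordPerm s L v) := by
  simp [wordPerm]

/-- The source of the edge of the Schreier graph that leaves `x` along the letter `l`. -/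
def edgeSource {α V : Type} (s : α → Equiv.Perm V) (l : α × Bool) (x : V) : V :=
  cond l.2 x ((s l.1)⁻¹ x)

/-- The extension of the permutations `s` to a new last coordinate that is translated along the edge
of the generator `i` with source `z`. -/
def twist {α V : Type} (s : α → Equiv.Perm V) (i : α) (z : V) (j : α) : Equiv.Perm (V × ℤ) := by
  classical exact deepHom V (s j) * (if j = i then deepBump z else 1)

theorem twist_apply_self {α V : Type} (s : α → Equiv.Perm V) (i : α) (z : V) (n : ℤ) :
    twist s i z i (z, n) = (s i z, n + 1) := by
  rw [twist, if_pos rfl, Equiv.Perm.mul_apply, deepBump_apply_self, deepHom_apply]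

theorem twist_apply_of_ne {α V : Type} (s : α → Equiv.Perm V) {i j : α} {z p : V}
    (h : ¬ (j = i ∧ p = z)) (n : ℤ) : twist s i z j (p, n) = (s j p, n) := by
  rw [twist]
  split_ifs with hj
  · rw [Equiv.Perm.mul_apply, deepBump_apply_of_ne (fun hp => h ⟨hj, hp⟩), deepHom_apply]
  · rw [mul_one, deepHom_apply]

theorem letterPerm_twist_of_ne {α V : Type} (s : α → Equiv.Perm V) {i : α} {l : α × Bool} {z p : V}
    (h : ¬ (l.1 = i ∧ edgeSource s l p = z)) (n : ℤ) :
    letterPerm (twist s i z) l (p, n) = (letterPerm s l p, n) := by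
  obtain ⟨j, b⟩ := l
  cases b
  · have h' : ¬ (j = i ∧ (s j)⁻¹ p = z) := h
    simp only [letterPerm, cond_false]
    rw [Equiv.Perm.inv_eq_iff_eq, twist_apply_of_ne s h']
    simp
  · exact twist_apply_of_ne s h n

/-- The marked edge changes the last coordinate by `1` when crossed forwards and by `-1` when
crossed backwards; an inverse letter leaving `p` crosses the edge whose source is its image. -/
theorem letterPerm_twist_self {α V : Type} (s : α → Equiv.Perm V) (l : α × Bool) (p : V) :
    ∃ n : ℤ, n ≠ 0 ∧
      letterPerm (twist s l.1 (edgeSource s l p)) l (p, 0) = (letterPerm s l p, n) := by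
  obtain ⟨j, b⟩ := l
  cases b
  · refine ⟨-1, by norm_num, ?_⟩
    simp only [letterPerm, edgeSource, cond_false]
    rw [Equiv.Perm.inv_eq_iff_eq, twist_apply_self]
    simp
  · refine ⟨1, by norm_num, ?_⟩
    simp only [letterPerm, edgeSource, cond_true]
    rw [twist_apply_self]; simp

/-- A reduced word moves a point along an injective path, for a suitable choice of permutations in
an iterated wreath product. -/
theorem exists_injective_path {α : Type} (L : List (α × Bool)) (hL : FreeGroup.IsReduced L) :
    ∃ (V : Type) (A : Subgroup (Equiv.Perm V)) (s : α → Equiv.Perm V), IteratedWreath V A ∧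
      (∀ i, s i ∈ A) ∧ ∃ v : V, ∀ L₁ L₂, L₁ <:+ L → L₂ <:+ L →
        wordPerm s L₁ v = wordPerm s L₂ v → L₁ = L₂ := by
  induction L with
  | nil =>
    refine ⟨Unit, ⊥, fun _ => 1, IteratedWreath.unit, fun _ => Subgroup.one_mem _, (),
      fun L₁ L₂ h1 h2 _ => ?_⟩
    rw [List.suffix_nil.1 h1, List.suffix_nil.1 h2]
  | cons l L ih =>
    obtain ⟨V, A, s, hA, hs, v, hinj⟩ := ih (List.IsChain.tail hL)
    obtain ⟨B, hB, hdeep, hbump⟩ := hA.deep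
    set x := wordPerm s L v with hx
    -- Words act on the left, so the suffixes of `L` are the successive stages of the path from `v`
    -- to `x`. The edge by which `l` leaves `x` is marked: if the path has not used it, the last
    -- coordinate stays `0` up to `x` and is nonzero after `l`, so the new vertex differs from all
    -- the earlier ones.
    set z := edgeSource s l x with hz
    have hpath : ∀ L', L' <:+ L →
        wordPerm (twist s l.1 z) L' (v, 0) = (wordPerm s L' v, 0) := by
      intro L' hL'
      induction L' with
      | nil => simp [wordPerm]
      | cons l' L' ih' =>
        have hs' : L' <:+ L := (List.suffix_cons l' L').trans hL'
        rw [wordPerm_cons, wordPerm_cons, ih' hs', letterPerm_twist_of_ne]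
        rintro ⟨h1, h2⟩
        obtain ⟨i, b⟩ := l
        obtain ⟨j, b'⟩ := l'
        obtain rfl : j = i := h1
        have hne : L' ≠ L := by
          rintro rfl
          have := hL'.length_le
          simp at this
        -- A crossing of the marked edge by `L` in the direction of `l` would start at `x`, before
        -- the end of the path, against injectivity.
        by_cases hb : b' = b
        · subst hb
          refine hne (hinj L' L hs' List.suffix_rfl ?_)
          rw [hz] at h2
          cases b'
          · exact (s j)⁻¹.injective h2
          · exact h2
        -- A crossing in the opposite direction arrives at `x`. By injectivity it is the last step
        -- of the path, so `l :: L` begins with a letter followed by its inverse and is not reduced.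
        · have hq : wordPerm s ((j, b') :: L') v = wordPerm s L v := by
            rw [wordPerm_cons, ← hx]
            rw [hz] at h2
            cases b <;> cases b'
            · exact absurd rfl hb
            · simp only [edgeSource, cond_true, cond_false] at h2
              simp only [letterPerm, cond_true]
              rw [h2]; simp
            · simp only [edgeSource, cond_true, cond_false] at h2
              simpa only [letterPerm, cond_false] using h2
            · exact absurd rfl hb
          have hLL := hinj _ _ hL' List.suffix_rfl hq
          rw [← hLL] at hL
          have := (List.isChain_cons_cons.1 hL).1 rfl
          exact hb this.symm
    obtain ⟨n, hn, hlast⟩ := letterPerm_twist_self s l x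
    have hlast' : wordPerm (twist s l.1 z) (l :: L) (v, 0) = (letterPerm s l x, n) := by
      rw [wordPerm_cons, hpath L List.suffix_rfl, ← hx]; exact hlast
    refine ⟨V × ℤ, B, twist s l.1 z, hB, fun j => ?_, (v, 0), fun L₁ L₂ h1 h2 h => ?_⟩
    · rw [twist]
      refine Subgroup.mul_mem _ (hdeep _ (hs j)) ?_
      split_ifs
      · exact hbump z
      · exact Subgroup.one_mem _
    · rcases List.suffix_cons_iff.1 h1 with rfl | h1' <;>
        rcases List.suffix_cons_iff.1 h2 with rfl | h2'
      · rfl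
      · rw [hlast', hpath _ h2'] at h
        exact absurd (congrArg Prod.snd h) hn
      · rw [hlast', hpath _ h1'] at h
        exact absurd (congrArg Prod.snd h).symm hn
      · rw [hpath _ h1', hpath _ h2'] at h
        exact hinj _ _ h1' h2' (congrArg Prod.fst h)

/-- Free groups are residually iterated wreath products of infinite cyclic groups. -/
theorem exists_lift_iteratedWreath_ne {α : Type} [DecidableEq α] {w : FreeGroup α} (hw : w ≠ 1) :
    ∃ (V : Type) (A : Subgroup (Equiv.Perm V)) (s : α → Equiv.Perm V), IteratedWreath V A ∧
      (∀ i, s i ∈ A) ∧ ∃ v : V, FreeGroup.lift s w v ≠ v := by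
  obtain ⟨V, A, s, hA, hs, v, hinj⟩ := exists_injective_path w.toWord FreeGroup.isReduced_toWord
  refine ⟨V, A, s, hA, hs, v, fun h => hw ?_⟩
  have h1 : FreeGroup.lift s w = wordPerm s w.toWord := by
    conv_lhs => rw [← FreeGroup.mk_toWord (x := w)]
    rw [FreeGroup.lift_mk]; rfl
  rw [h1] at h
  have := hinj w.toWord [] List.suffix_rfl List.nil_suffix (by simpa [wordPerm] using h)
  exact FreeGroup.toWord_eq_nil_iff.1 this

/-! ### Realization by diffeomorphisms of the interval -/

/-- The iterated wreath products act on the interval by totally rational groups of diffeomorphisms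
that are close to the identity. -/
theorem IteratedWreath.exists_realization {V : Type} {A : Subgroup (Equiv.Perm V)}
    (h : IteratedWreath V A) :
    ∃ (G : Subgroup (Icc (0 : ℝ) 1 ≃o Icc (0 : ℝ) 1)) (ψ : ℕ → Icc (0 : ℝ) 1 → ℝ)
      (p : V → Icc (0 : ℝ) 1), IntegrallyRational G ∧ IsDensitySeq ψ ∧ G ≤ closeGroup ψ ∧
      Function.Injective p ∧ (∀ v, (p v : ℝ) < 1) ∧
      ∀ s ∈ A, ∃ g ∈ G, ∀ v, g (p v) = p (s v) := by
  induction h with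
  | unit =>
    exact ⟨⊥, fun _ _ => 0, fun _ => 0, integrallyRational_bot,
      fun n => ⟨continuous_const, rfl, rfl⟩, bot_le, fun v w _ => Subsingleton.elim v w,
      fun _ => zero_lt_one, fun s _ => ⟨1, Subgroup.one_mem _, fun v => rfl⟩⟩
  | @wreath V A _ ih =>
    obtain ⟨G, ψ, p, hr, hψ, hG, hinj, hlt, hact⟩ := ih
    obtain ⟨Ψ, hΨ, hΨ1, hΨG⟩ := exists_isDensitySeq_wreath hψ
    set ρ : (Icc (0 : ℝ) 1 ≃o Icc (0 : ℝ) 1) → (Icc (0 : ℝ) 1 ≃o Icc (0 : ℝ) 1) :=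
      fun g => unitChart.ext (glue 0 (Pi.mulSingle 0 g)) with hρ
    set G' := Subgroup.closure (insert (unitChart.ext (glue 1 1)) (ρ '' G)) with hG'
    refine ⟨G', Ψ, fun v => cellMap v.1 (p v.2), ?_, hΨ, ?_, ?_, ?_, ?_⟩
    -- `G'` lies in the unrestricted wreath product, in which every cell carries an arbitrary
    -- element of `G`.
    · refine (integrallyRational_cellGroup (L := ⊤) (K := fun _ => G) (fun _ _ _ => rfl)
        fun _ => hr).mono ?_
      rw [hG', Subgroup.closure_le]
      rintro _ (rfl | ⟨g, hg, rfl⟩)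
      · exact ⟨1, trivial, 1, fun m => G.one_mem, rfl⟩
      · refine ⟨0, trivial, _, fun m => ?_, rfl⟩
        by_cases hm : m = 0
        · subst hm; simpa using hg
        · have : (Pi.mulSingle 0 g : ℤ → (Icc (0 : ℝ) 1 ≃o Icc (0 : ℝ) 1)) m = 1 := by
            simp [Pi.mulSingle, hm]
          rw [this]; exact G.one_mem
    · rw [hG', Subgroup.closure_le]
      rintro _ (rfl | ⟨g, hg, rfl⟩)
      · exact hΨ1
      · exact hΨG g (hG hg)
    · rintro ⟨m, v⟩ ⟨n, w⟩ h
      have h1 := unitChart.strictMono.injective h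
      have h2 := congrArg Int.floor h1
      rw [floor_int_add (hlt _), floor_int_add (hlt _)] at h2
      dsimp only at h2
      -- As `p v < 1`, the floor of the coordinate determines the cell.
      subst h2
      exact Prod.ext rfl (hinj (cellMap_injective _ h))
    · exact fun v => unitChart_lt_one _
    · intro s hs
      refine Subgroup.closure_induction (p := fun s _ => ∃ g ∈ G', ∀ v : ℤ × V,
        g (cellMap v.1 (p v.2)) = cellMap (s v).1 (p (s v).2)) ?_ ?_ ?_ ?_ hs
      · rintro _ (rfl | ⟨s, hs, rfl⟩)
        · refine ⟨_, Subgroup.subset_closure (mem_insert _ _), fun v => ?_⟩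
          rw [ext_glue_cellMap]; rfl
        · obtain ⟨g, hg, hgs⟩ := hact s hs
          refine ⟨ρ g, Subgroup.subset_closure (mem_insert_of_mem _ ⟨g, hg, rfl⟩), ?_⟩
          rintro ⟨m, v⟩
          rw [placeHom_apply, hρ]
          dsimp only
          rw [ext_glue_cellMap, add_zero]
          by_cases hm : m = 0
          · subst hm; simp [hgs]
          · simp [Pi.mulSingle, hm]
      · exact ⟨1, Subgroup.one_mem _, fun v => rfl⟩
      · rintro s t - - ⟨g, hg, hgs⟩ ⟨h, hh, hht⟩
        refine ⟨g * h, Subgroup.mul_mem _ hg hh, fun v => ?_⟩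
        rw [RelIso.mul_apply, hht, hgs]; rfl
      · rintro s - ⟨g, hg, hgs⟩
        refine ⟨g⁻¹, Subgroup.inv_mem _ hg, fun v => ?_⟩
        rw [← g.injective.eq_iff, ← RelIso.mul_apply, mul_inv_cancel, RelIso.one_apply, hgs,
          ← Equiv.Perm.mul_apply, mul_inv_cancel, Equiv.Perm.one_apply]
  | @congr V W A B e _ hAB ih =>
    obtain ⟨G, ψ, p, hr, hψ, hG, hinj, hlt, hact⟩ := ih
    refine ⟨G, ψ, p ∘ e, hr, hψ, hG, hinj.comp e.injective, fun v => hlt _, fun s hs => ?_⟩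
    obtain ⟨g, hg, hgs⟩ := hact _ (hAB s hs)
    refine ⟨g, hg, fun v => ?_⟩
    rw [Function.comp_apply, hgs]; simp

/-! ### A free group close to the identity -/

/-- One word is detected at a time, with generators near the identity: the bound `ε` is what later
allows infinitely many such representations to be glued into a C¹ action. -/
theorem exists_representation {α : Type} [Finite α] (w : FreeGroup α) {ε : ℝ} (hε : 0 < ε) :
    ∃ (F : FreeGroup α →* (Icc (0 : ℝ) 1 ≃o Icc (0 : ℝ) 1)) (ψ : ℕ → Icc (0 : ℝ) 1 → ℝ)
      (u : α → Icc (0 : ℝ) 1 → ℝ), IntegrallyRational F.range ∧ IsDensitySeq ψ ∧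
      (∀ i, CloseWith ψ (F (FreeGroup.of i)) (u i)) ∧ (∀ i x, |u i x| ≤ ε) ∧ (w ≠ 1 → F w ≠ 1) := by
  classical
  by_cases hw : w = 1
  · refine ⟨1, fun _ _ => 0, fun _ _ => 0, integrallyRational_bot.mono ?_,
      fun n => ⟨continuous_const, rfl, rfl⟩,
      fun i => ⟨hasLogDeriv_one, rfl, rfl, fun ε hε => Eventually.of_forall fun n x => ?_⟩,
      fun i x => by simpa using hε.le, fun h => absurd hw h⟩
    · rintro _ ⟨g, rfl⟩; exact Subgroup.one_mem _
    · simpa using hε.le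
  · obtain ⟨V, A, s, hA, hs, v, hv⟩ := exists_lift_iteratedWreath_ne hw
    obtain ⟨G, ψ, p, hr, hψ, hG, hinj, hlt, hact⟩ := hA.exists_realization
    choose g hgG hg using fun i => hact (s i) (hs i)
    choose u hu using fun i => hG (hgG i)
    set F₀ : FreeGroup α →* (Icc (0 : ℝ) 1 ≃o Icc (0 : ℝ) 1) := FreeGroup.lift g with hF₀
    have hF₀G : F₀.range ≤ G := by
      rw [hF₀, FreeGroup.range_lift_eq_closure, Subgroup.closure_le]
      rintro _ ⟨i, rfl⟩; exact hgG i
    -- Each generator follows its permutation on the points `p v`, hence so does every word; a word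
    -- moving `v` therefore acts nontrivially.
    have hF₀p : ∀ (w : FreeGroup α) v, F₀ w (p v) = p (FreeGroup.lift s w v) := by
      intro w
      induction w using FreeGroup.induction_on with
      | C1 => intro v; simp
      | of i => intro v; simp [hF₀, hg]
      | inv_of i _ =>
        intro v
        rw [map_inv, map_inv, ← (F₀ (FreeGroup.of i)).injective.eq_iff, ← RelIso.mul_apply,
          mul_inv_cancel, RelIso.one_apply]
        simp only [hF₀, FreeGroup.lift_apply_of, hg]
        simp
      | mul x y hx hy =>
        intro v
        rw [map_mul, map_mul, RelIso.mul_apply, hy, hx]; rfl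
    -- Conjugation by the diffeomorphism of density proportional to `exp (ψ k)` makes all the
    -- logarithmic derivatives of the generators at most `ε`.
    obtain ⟨k, hk⟩ := (eventually_all.2 fun i => (hu i).2.2.2 ε hε).exists
    obtain ⟨h, c, hh⟩ := exists_hasLogDeriv_sub_const (hψ k).1
    refine ⟨(MulAut.conj h).toMonoidHom.comp F₀, fun n x => ψ n (h⁻¹ x) - ψ k (h⁻¹ x),
      fun i x => u i (h⁻¹ x) + ψ k (g i (h⁻¹ x)) - ψ k (h⁻¹ x), (hr.conj h).mono ?_, fun n => ?_,
      fun i => ?_, fun i x => hk i _, fun _ hFw => hv ?_⟩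
    · rintro _ ⟨x, rfl⟩
      exact ⟨F₀ x, hF₀G ⟨x, rfl⟩, rfl⟩
    · refine ⟨((hψ n).1.comp h⁻¹.continuous).sub ((hψ k).1.comp h⁻¹.continuous), ?_, ?_⟩
      · simp [orderIso_zero, (hψ n).2.1, (hψ k).2.1]
      · simp [orderIso_one, (hψ n).2.2, (hψ k).2.2]
    · have := (hu i).conj (hψ k).2.1 (hψ k).2.2 hh
      simpa [hF₀] using this
    · have h1 : F₀ w = 1 := by
        apply (MulAut.conj h).injective
        rw [map_one]; exact hFw
      have h2 := hF₀p w v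
      rw [h1, RelIso.one_apply] at h2
      exact (hinj h2).symm

/-- Free groups of finite rank act faithfully on the interval by totally rational groups of
diffeomorphisms that are close to the identity. -/
theorem exists_faithful_representation (α : Type) [Finite α] :
    ∃ (ρ : FreeGroup α →* (Icc (0 : ℝ) 1 ≃o Icc (0 : ℝ) 1)) (ψ : ℕ → Icc (0 : ℝ) 1 → ℝ),
      Function.Injective ρ ∧ IntegrallyRational ρ.range ∧ IsDensitySeq ψ ∧
        ρ.range ≤ closeGroup ψ := by
  obtain ⟨e, he⟩ := exists_surjective_nat (FreeGroup α)
  -- The cell `m` is devoted to the `|m|`-th word of an enumeration, with a bound that tends to `0`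
  -- as the cells approach the ends.
  choose F ψ u hr hψ hu hsmall hne using fun m : ℤ =>
    exists_representation (e m.natAbs) (ε := 1 / (|(m : ℝ)| + 1)) (by positivity)
  obtain ⟨Ψ, hΨ, hΨF⟩ := exists_isDensitySeq_union (F := fun i m => F m (FreeGroup.of i))
    (u := fun i m => u m i) hψ (fun i m => hu m i) (fun i m x => hsmall m i x)
  set ρ : FreeGroup α →* (Icc (0 : ℝ) 1 ≃o Icc (0 : ℝ) 1) :=
    unitChart.ext.comp (glueHom.comp (MonoidHom.pi F)) with hρ
  have hρF : ∀ w, ρ w = unitChart.ext (glue 0 fun m => F m w) := fun w => rfl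
  refine ⟨ρ, Ψ, ?_, ?_, hΨ, ?_⟩
  · rw [injective_iff_map_eq_one]
    intro w hw
    obtain ⟨n, rfl⟩ := he w
    by_contra h
    rw [hρF, ← map_one unitChart.ext, ← glue_one] at hw
    have := congrFun (glue_injective (unitChart.ext_injective hw)) n
    exact hne n (by simpa using h) (by simpa using this)
  -- No cell is translated here, so the groups in the cells may be unrelated.
  · refine (integrallyRational_cellGroup (L := ⊥) (K := fun m => (F m).range) ?_ hr).mono ?_
    · rintro c hc m
      rw [AddSubgroup.mem_bot.1 hc, add_zero]
    · rintro _ ⟨w, rfl⟩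
      exact ⟨0, rfl, _, fun m => ⟨w, rfl⟩, hρF w⟩
  · have : ρ = FreeGroup.lift fun i => unitChart.ext (glue 0 fun m => F m (FreeGroup.of i)) := by
      ext1 i
      simp [hρF]
    rw [this, FreeGroup.range_lift_eq_closure, Subgroup.closure_le]
    rintro _ ⟨i, rfl⟩
    exact hΨF i

/-- The conjugating diffeomorphisms are those with derivative `exp (ψ n - c n)`, which do not depend
on the element of `G`. -/
theorem c1CloseToId_of_le_closeGroup {G : Subgroup (Icc (0 : ℝ) 1 ≃o Icc (0 : ℝ) 1)}
    {ψ : ℕ → Icc (0 : ℝ) 1 → ℝ} (hψ : IsDensitySeq ψ) (hG : G ≤ closeGroup ψ) : C1CloseToId G := by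
  refine ⟨fun g hg => ?_, ?_⟩
  · obtain ⟨u, hu⟩ := hG hg
    exact hu.1.mem_Diff Icc_zero_one_uniqueDiffOn
  · choose h c hh using fun n => exists_hasLogDeriv_sub_const (hψ n).1
    refine ⟨h, fun n => (hh n).mem_Diff Icc_zero_one_uniqueDiffOn, fun g hg => ?_⟩
    obtain ⟨u, hu⟩ := hG hg
    have hd := fun n => (hu.conj (hψ n).2.1 (hψ n).2.2 (hh n)).1
    have hsmall : ∀ ε > 0, ∀ᶠ n in atTop, ∀ x,
        |Real.exp (u ((h n)⁻¹ x) + ψ n (g ((h n)⁻¹ x)) - ψ n ((h n)⁻¹ x)) - 1| ≤ ε := by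
      intro ε hε
      -- For `|y| ≤ 1` one has `|exp y - 1| ≤ 2 * |y|`.
      filter_upwards [hu.2.2.2 (min 1 (ε / 2)) (by positivity)] with n hn x
      have h1 := hn ((h n)⁻¹ x)
      refine (Real.abs_exp_sub_one_le (h1.trans (min_le_left _ _))).trans ?_
      linarith [h1.trans (min_le_right _ _)]
    constructor
    · rw [Metric.tendstoUniformlyOn_iff]
      intro ε hε
      filter_upwards [hsmall (ε / 2) (by positivity)] with n hn x hx
      have := (hd n).abs_sub_le hn ⟨x, hx⟩
      rw [dist_comm, Real.dist_eq, toFun_of_mem _ hx]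
      linarith
    · rw [Metric.tendstoUniformlyOn_iff]
      intro ε hε
      filter_upwards [hsmall (ε / 2) (by positivity)] with n hn x hx
      have h2 := ((hd n).2 ⟨x, hx⟩).derivWithin (Icc_zero_one_uniqueDiffOn x hx)
      rw [dist_comm, Real.dist_eq, h2]
      linarith [hn ⟨x, hx⟩]

/-! ### Slowly varying sequences of densities -/

/-- `σ k` is the largest `n ≤ k` such that the bounds up to `n` do not exceed `log (1 + k)`; each
index is thus repeated until the next bounds are affordable, and `h0` provides a starting value. -/
theorem exists_slow_subsequence {B : ℕ → ℝ} (h0 : B 0 = 0) :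
    ∃ σ : ℕ → ℕ, Tendsto σ atTop atTop ∧ ∀ k : ℕ, B (σ k) ≤ Real.log (1 + k) := by
  classical
  let P : ℕ → ℕ → Prop := fun k n => ∀ j ≤ n, B j ≤ Real.log (1 + k)
  have hP0 : ∀ k, P k 0 := fun k j hj => by
    rw [Nat.le_zero.1 hj, h0]
    exact Real.log_nonneg (by linarith [(Nat.cast_nonneg k : (0 : ℝ) ≤ k)])
  refine ⟨fun k => Nat.findGreatest (P k) k, ?_, fun k =>
    Nat.findGreatest_spec (P := P k) (Nat.zero_le k) (hP0 k) _ le_rfl⟩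
  rw [tendsto_atTop]
  intro N
  have hlog : Tendsto (fun k : ℕ => Real.log (1 + k)) atTop atTop :=
    Real.tendsto_log_atTop.comp (tendsto_atTop_add_const_left _ _ tendsto_natCast_atTop_atTop)
  have h1 : ∀ᶠ k : ℕ in atTop, ∀ j ∈ Finset.range (N + 1), B j ≤ Real.log (1 + k) :=
    (Finset.eventually_all _).2 fun j _ => hlog.eventually_ge_atTop (B j)
  filter_upwards [h1, eventually_ge_atTop N] with k hk hN
  exact Nat.le_findGreatest hN fun j hj => hk j (Finset.mem_range.2 (by omega))

/-- A sequence of densities that brings a group close to the identity can be replaced by a sequence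
that varies slowly and grows slowly. -/
theorem exists_slow_densitySeq {ψ : ℕ → Icc (0 : ℝ) 1 → ℝ} (hψ : IsDensitySeq ψ) :
    ∃ φ : ℕ → Icc (0 : ℝ) 1 → ℝ, IsDensitySeq φ ∧ (∀ x, φ 0 x = 0) ∧
      (∀ k x, |φ k x| ≤ Real.log (1 + k)) ∧
      (∀ ε > 0, ∀ᶠ k in atTop, ∀ x, |φ (k + 1) x - φ k x| ≤ ε) ∧
      ∀ g u, CloseWith ψ g u → CloseWith φ g u := by
  choose B hB0 hB using fun n => exists_bound (hψ n).1
  -- A zero density is prepended, as the bound for `k = 0` is `log 1 = 0`.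
  set ψ' : ℕ → Icc (0 : ℝ) 1 → ℝ := fun n => Nat.casesOn n (fun _ => 0) ψ with hψ'
  set B' : ℕ → ℝ := fun n => Nat.casesOn n 0 B with hB'
  have hB'ψ : ∀ n x, |ψ' n x| ≤ B' n := by
    rintro (_ | n) x
    · simp [hψ', hB']
    · exact hB n x
  have hψ'd : IsDensitySeq ψ' := by
    rintro (_ | n)
    · exact ⟨continuous_const, rfl, rfl⟩
    · exact hψ n
  obtain ⟨σ, hσ, hσB⟩ := exists_slow_subsequence (B := B') rfl
  set θ : ℕ → Icc (0 : ℝ) 1 → ℝ := fun k => ψ' (σ k) with hθ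
  have hθb : ∀ k x, |θ k x| ≤ Real.log (1 + k) := fun k x => (hB'ψ _ x).trans (hσB k)
  -- Cesàro means vary slowly: `φ (k + 1) - φ k = (θ k - φ k) / (k + 1)` is at most `2 * log (1 + k)
  -- / (1 + k)`. They keep the group close to the identity because the corrected cocycle is affine
  -- in the density. At `k = 0` the sum is empty, so `φ 0 = 0`.
  set φ : ℕ → Icc (0 : ℝ) 1 → ℝ := fun k x => (k : ℝ)⁻¹ * ∑ i ∈ Finset.range k, θ i x with hφ
  have hsum : ∀ k x, ∑ i ∈ Finset.range k, θ i x = k * φ k x := by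
    intro k x
    rcases Nat.eq_zero_or_pos k with rfl | hk
    · simp
    · have : (k : ℝ) ≠ 0 := by positivity
      simp only [hφ]; field_simp
  have hφb : ∀ k x, |φ k x| ≤ Real.log (1 + k) := by
    intro k x
    rcases Nat.eq_zero_or_pos k with rfl | hk
    · simp [hφ]
    · have hk' : (0 : ℝ) < k := by exact_mod_cast hk
      rw [hφ]
      dsimp only
      rw [abs_mul, abs_inv, abs_of_pos hk', inv_mul_le_iff₀ hk']
      calc |∑ i ∈ Finset.range k, θ i x| ≤ ∑ i ∈ Finset.range k, |θ i x| :=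
            Finset.abs_sum_le_sum_abs _ _
        _ ≤ ∑ i ∈ Finset.range k, Real.log (1 + k) := by
            refine Finset.sum_le_sum fun i hi => (hθb i x).trans ?_
            have : (i : ℝ) ≤ k := by exact_mod_cast (Finset.mem_range.1 hi).le
            exact Real.log_le_log (by positivity) (by linarith)
        _ = k * Real.log (1 + k) := by simp
  refine ⟨φ, fun k => ⟨?_, ?_, ?_⟩, fun x => by simp [hφ], hφb, ?_, ?_⟩
  · exact continuous_const.mul (continuous_finsetSum _ fun i _ => (hψ'd _).1)
  · simp [hφ, hθ, (hψ'd _).2.1]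
  · simp [hφ, hθ, (hψ'd _).2.2]
  · intro ε hε
    have hlim : Tendsto (fun k : ℕ => 2 * (Real.log (1 + k) / (1 + k))) atTop (𝓝 (2 * 0)) := by
      have h1 := Real.isLittleO_log_id_atTop.tendsto_div_nhds_zero
      exact (h1.comp (tendsto_atTop_add_const_left _ (1 : ℝ) tendsto_natCast_atTop_atTop)).const_mul 2
    rw [mul_zero] at hlim
    filter_upwards [hlim.eventually (gt_mem_nhds hε)] with k hk x
    have hk0 : (0 : ℝ) < 1 + k := by positivity
    have h1 : φ (k + 1) x - φ k x = (θ k x - φ k x) / (1 + k) := by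
      have h2 := hsum (k + 1) x
      rw [Finset.sum_range_succ, hsum k x] at h2
      rw [eq_div_iff hk0.ne']
      push_cast at h2
      linarith
    rw [h1, abs_div, abs_of_pos hk0]
    refine le_trans ?_ hk.le
    rw [← mul_div_assoc]
    gcongr
    refine (abs_sub _ _).trans ?_
    linarith [hθb k x, hφb k x]
  · rintro g u ⟨hu, hu0, hu1, hlim⟩
    refine ⟨hu, hu0, hu1, fun ε hε => ?_⟩
    have hθlim : ∀ ε > 0, ∀ᶠ k in atTop, ∀ x, |u x + θ k (g x) - θ k x| ≤ ε := by
      intro ε hε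
      refine hσ.eventually (p := fun n => ∀ x, |u x + ψ' n (g x) - ψ' n x| ≤ ε) ?_
      -- The shift undoes the prepended term.
      rw [← map_add_atTop_eq_nat 1, eventually_map]
      exact hlim ε hε
    let e : ℕ → C(Icc (0 : ℝ) 1, ℝ) := fun k =>
      ⟨fun x => u x + θ k (g x) - θ k x,
        (hu.1.add ((hψ'd _).1.comp g.continuous)).sub (hψ'd _).1⟩
    have he : Tendsto e atTop (𝓝 0) := by
      rw [Metric.tendsto_nhds]
      intro δ hδ
      filter_upwards [hθlim (δ / 2) (by positivity)] with k hk
      rw [dist_zero_right]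
      refine lt_of_le_of_lt ((ContinuousMap.norm_le _ (by positivity)).2 hk) (half_lt_self hδ)
    -- Cesàro's theorem is applied in the normed space of continuous functions, which yields
    -- uniformity in `x`.
    have hc := he.cesaro_smul
    rw [Metric.tendsto_nhds] at hc
    filter_upwards [hc ε hε, eventually_gt_atTop 0] with k hk hk0 x
    have hk' : (k : ℝ) ≠ 0 := by exact_mod_cast hk0.ne'
    rw [dist_zero_right] at hk
    have h1 := (ContinuousMap.norm_coe_le_norm _ x).trans hk.le
    have h2 : ((k : ℝ)⁻¹ • ∑ i ∈ Finset.range k, e i) x = u x + φ k (g x) - φ k x := by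
      rw [ContinuousMap.smul_apply, ContinuousMap.sum_apply]
      change (k : ℝ)⁻¹ * ∑ i ∈ Finset.range k, (u x + θ i (g x) - θ i x) = _
      rw [Finset.sum_sub_distrib, Finset.sum_add_distrib, hsum, hsum]
      simp only [Finset.sum_const, Finset.card_range, nsmul_eq_mul]
      field_simp
    rwa [h2, Real.norm_eq_abs] at h1

/-! ### A contraction of the half line -/

/-- The function that is `- 4 log (1 + |t|)` for `t ≤ 0` and `0` for `t ≥ 0`. -/
def negLog (t : ℝ) : ℝ := -4 * Real.log (1 + max (-t) 0)

theorem negLog_arg_pos (t : ℝ) : 0 < 1 + max (-t) 0 := by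
  linarith [le_max_right (-t) 0]

theorem continuous_negLog : Continuous negLog :=
  continuous_const.mul (Continuous.log (by fun_prop) fun t => (negLog_arg_pos t).ne')

theorem negLog_of_nonneg {t : ℝ} (ht : 0 ≤ t) : negLog t = 0 := by
  rw [negLog, max_eq_right (by linarith)]; simp

theorem abs_negLog_sub_le {N s t : ℝ} (hN : 0 < N) (hs : s ≤ -N) (ht : t ≤ -N) :
    |negLog s - negLog t| ≤ 4 * |s - t| / N := by
  have h1 := abs_log_sub_log_le (a := 1 + max (-s) 0) (b := 1 + max (-t) 0) hN
    (by linarith [le_max_left (-s) 0]) (by linarith [le_max_left (-t) 0])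
  rw [max_eq_left (by linarith), max_eq_left (by linarith)] at h1
  have h2 : (1 + -s) - (1 + -t) = -(s - t) := by ring
  rw [h2, abs_neg] at h1
  rw [negLog, negLog, max_eq_left (by linarith), max_eq_left (by linarith), ← mul_sub, abs_mul,
    mul_div_assoc]
  norm_num
  exact h1

/-- The logarithm of a density on the line, given by the densities `φ k` in the cells. -/
def halfLineLog (φ : ℕ → Icc (0 : ℝ) 1 → ℝ) (t : ℝ) : ℝ :=
  negLog t + cells (fun m => φ (-m).toNat) t

theorem halfLineLog_add {φ : ℕ → Icc (0 : ℝ) 1 → ℝ} (hφ : IsDensitySeq φ) (m : ℤ)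
    (x : Icc (0 : ℝ) 1) : halfLineLog φ (m + x) = negLog (m + x) + φ (-m).toNat x := by
  rw [halfLineLog, cells_add (fun m => (hφ _).2.1) (fun m => (hφ _).2.2)]

theorem continuous_halfLineLog {φ : ℕ → Icc (0 : ℝ) 1 → ℝ} (hφ : IsDensitySeq φ) :
    Continuous (halfLineLog φ) :=
  continuous_negLog.add (continuous_cells (fun _ => (hφ _).1) (fun _ => (hφ _).2.1)
    (fun _ => (hφ _).2.2))

theorem halfLineLog_of_nonneg {φ : ℕ → Icc (0 : ℝ) 1 → ℝ} (hφ : IsDensitySeq φ)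
    (h0 : ∀ x, φ 0 x = 0) {t : ℝ} (ht : 0 ≤ t) : halfLineLog φ t = 0 := by
  obtain ⟨m, x, hx, rfl⟩ := exists_int_add t
  have hm : 0 ≤ m := by
    have := Int.floor_nonneg.2 ht
    rwa [floor_int_add hx] at this
  rw [halfLineLog_add hφ, negLog_of_nonneg ht, Int.toNat_of_nonpos (by omega), h0, add_zero]

/-- The logarithmic growth of `φ` costs one power of `1 + |t|` out of the four in `negLog`. The
remaining exponent `-3` is integrable at `-∞`, which puts the origin of the half line at finite
distance. -/
theorem exp_halfLineLog_le {φ : ℕ → Icc (0 : ℝ) 1 → ℝ} (hφ : IsDensitySeq φ)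
    (hb : ∀ k x, |φ k x| ≤ Real.log (1 + k)) {t : ℝ} (ht : t ≤ 0) :
    Real.exp (halfLineLog φ t) ≤ 2 * (1 + ‖t‖) ^ (-3 : ℝ) := by
  obtain ⟨m, x, hx, rfl⟩ := exists_int_add t
  rw [halfLineLog_add hφ, Real.exp_add, Real.norm_eq_abs, abs_of_nonpos ht]
  have hm : m ≤ 0 := by
    have : (m : ℝ) ≤ 0 := by linarith [x.2.1]
    exact_mod_cast this
  set s : ℝ := 1 + -((m : ℝ) + x) with hs
  have hs1 : 1 ≤ s := by linarith
  have hspos : 0 < s := by linarith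
  have h1 : Real.exp (negLog (m + x)) = s ^ (-4 : ℝ) := by
    rw [negLog, max_eq_left (by linarith), Real.rpow_def_of_pos hspos, mul_comm]
  have hk : (((-m).toNat : ℕ) : ℝ) = -m := by
    have h2 : (((-m).toNat : ℕ) : ℤ) = -m := Int.toNat_of_nonneg (by omega)
    have h3 : ((((-m).toNat : ℕ) : ℤ) : ℝ) = ((-m : ℤ) : ℝ) := by rw [h2]
    push_cast at h3
    exact h3
  have h2 : Real.exp (φ (-m).toNat x) ≤ 2 * s := by
    calc Real.exp (φ (-m).toNat x) ≤ Real.exp (Real.log (1 + ((-m).toNat : ℕ))) :=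
          Real.exp_le_exp.2 ((le_abs_self _).trans (hb _ _))
      _ = 1 + ((-m).toNat : ℕ) := Real.exp_log (by positivity)
      _ ≤ 2 * s := by rw [hk]; linarith
  rw [h1]
  calc s ^ (-4 : ℝ) * Real.exp (φ (-m).toNat x) ≤ s ^ (-4 : ℝ) * (2 * s) := by gcongr
    _ = 2 * (s ^ (-4 : ℝ) * s ^ (1 : ℝ)) := by rw [Real.rpow_one]; ring
    _ = 2 * s ^ (-3 : ℝ) := by rw [← Real.rpow_add hspos]; norm_num

theorem integrableOn_exp_halfLineLog {φ : ℕ → Icc (0 : ℝ) 1 → ℝ} (hφ : IsDensitySeq φ)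
    (hb : ∀ k x, |φ k x| ≤ Real.log (1 + k)) (a : ℝ) :
    MeasureTheory.IntegrableOn (fun t => Real.exp (halfLineLog φ t)) (Iic a) := by
  have hc : Continuous fun t => Real.exp (halfLineLog φ t) :=
    Real.continuous_exp.comp (continuous_halfLineLog hφ)
  have h0 : MeasureTheory.IntegrableOn (fun t => Real.exp (halfLineLog φ t)) (Iic 0) := by
    have h1 : MeasureTheory.Integrable fun t : ℝ => 2 * (1 + ‖t‖) ^ (-3 : ℝ) :=
      (integrable_one_add_norm (by simp)).const_mul 2
    refine MeasureTheory.Integrable.mono' h1.integrableOn hc.aestronglyMeasurable ?_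
    refine (MeasureTheory.ae_restrict_mem measurableSet_Iic).mono fun t ht => ?_
    rw [Real.norm_eq_abs, abs_of_pos (Real.exp_pos _)]
    exact exp_halfLineLog_le hφ hb ht
  refine (h0.union (hc.integrableOn_Icc (a := 0) (b := a))).mono_set fun t ht => ?_
  rcases le_total t 0 with h | h
  · exact Or.inl h
  · exact Or.inr ⟨h, ht⟩

/-- The primitive of the density `exp (halfLineLog φ)`. -/
def halfLineParam (φ : ℕ → Icc (0 : ℝ) 1 → ℝ) (t : ℝ) : ℝ :=
  ∫ s in Iic t, Real.exp (halfLineLog φ s)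

theorem halfLineParam_eq {φ : ℕ → Icc (0 : ℝ) 1 → ℝ} (hφ : IsDensitySeq φ)
    (hb : ∀ k x, |φ k x| ≤ Real.log (1 + k)) (t : ℝ) :
    halfLineParam φ t = halfLineParam φ 0 + ∫ s in (0 : ℝ)..t, Real.exp (halfLineLog φ s) := by
  rw [← intervalIntegral.integral_Iic_sub_Iic (integrableOn_exp_halfLineLog hφ hb 0)
    (integrableOn_exp_halfLineLog hφ hb t)]
  simp only [halfLineParam]; ring

theorem hasDerivAt_halfLineParam {φ : ℕ → Icc (0 : ℝ) 1 → ℝ} (hφ : IsDensitySeq φ)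
    (hb : ∀ k x, |φ k x| ≤ Real.log (1 + k)) (t : ℝ) :
    HasDerivAt (halfLineParam φ) (Real.exp (halfLineLog φ t)) t := by
  have hc : Continuous fun t => Real.exp (halfLineLog φ t) :=
    Real.continuous_exp.comp (continuous_halfLineLog hφ)
  rw [funext (halfLineParam_eq hφ hb)]
  exact (intervalIntegral.integral_hasDerivAt_right (hc.intervalIntegrable _ _)
    hc.stronglyMeasurable.stronglyMeasurableAtFilter hc.continuousAt).const_add _

theorem halfLineParam_strictMono {φ : ℕ → Icc (0 : ℝ) 1 → ℝ} (hφ : IsDensitySeq φ)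
    (hb : ∀ k x, |φ k x| ≤ Real.log (1 + k)) : StrictMono (halfLineParam φ) :=
  strictMono_of_deriv_pos fun t => by
    rw [(hasDerivAt_halfLineParam hφ hb t).deriv]; exact Real.exp_pos _

theorem halfLineParam_pos {φ : ℕ → Icc (0 : ℝ) 1 → ℝ} (hφ : IsDensitySeq φ)
    (hb : ∀ k x, |φ k x| ≤ Real.log (1 + k)) (t : ℝ) : 0 < halfLineParam φ t := by
  refine lt_of_le_of_lt ?_ (halfLineParam_strictMono hφ hb (sub_one_lt t))
  exact MeasureTheory.integral_nonneg fun s => (Real.exp_pos _).le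

theorem tendsto_halfLineParam_atBot {φ : ℕ → Icc (0 : ℝ) 1 → ℝ} (hφ : IsDensitySeq φ)
    (hb : ∀ k x, |φ k x| ≤ Real.log (1 + k)) : Tendsto (halfLineParam φ) atBot (𝓝 0) := by
  have h1 := MeasureTheory.intervalIntegral_tendsto_integral_Iic 0
    (integrableOn_exp_halfLineLog hφ hb 0) tendsto_id
  have h2 : Tendsto (fun t => halfLineParam φ 0 - ∫ s in t..0, Real.exp (halfLineLog φ s)) atBot
      (𝓝 (halfLineParam φ 0 - halfLineParam φ 0)) := tendsto_const_nhds.sub h1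
  rw [sub_self] at h2
  refine h2.congr fun t => ?_
  rw [halfLineParam_eq hφ hb t, intervalIntegral.integral_symm]; ring

/-- The density is `1` on `[0, ∞)`, since `toNat` sends `-m` to `0` for `m ≥ 0` and `φ 0 = 0`; the
chart therefore reaches arbitrarily far. -/
theorem exists_lt_halfLineParam {φ : ℕ → Icc (0 : ℝ) 1 → ℝ} (hφ : IsDensitySeq φ)
    (hb : ∀ k x, |φ k x| ≤ Real.log (1 + k)) (h0 : ∀ x, φ 0 x = 0) (s : ℝ) : ∃ t, s < halfLineParam φ t := by
  refine ⟨|s|, ?_⟩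
  rw [halfLineParam_eq hφ hb]
  have h1 : ∫ r in (0 : ℝ)..|s|, Real.exp (halfLineLog φ r) = ∫ r in (0 : ℝ)..|s|, (1 : ℝ) := by
    refine intervalIntegral.integral_congr fun r hr => ?_
    rw [uIcc_of_le (abs_nonneg s)] at hr
    rw [halfLineLog_of_nonneg hφ h0 hr.1, Real.exp_zero]
  rw [h1]
  simp only [intervalIntegral.integral_const, sub_zero, smul_eq_mul, mul_one]
  linarith [halfLineParam_pos hφ hb 0, le_abs_self s]

theorem halfLineParam_cover {φ : ℕ → Icc (0 : ℝ) 1 → ℝ} (hφ : IsDensitySeq φ)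
    (hb : ∀ k x, |φ k x| ≤ Real.log (1 + k)) (s : Ici (0 : ℝ))
    (hs : (s : ℝ) ≠ 0) : (s : ℝ) ∈ range (halfLineParam φ) ∨
    ∀ t, halfLineParam φ t < s := by
  by_cases h : ∀ t, halfLineParam φ t < s
  · exact Or.inr h
  · left
    push Not at h
    have hs0 : (0 : ℝ) < s := lt_of_le_of_ne s.2 hs.symm
    refine mem_range_of_exists_le_of_exists_ge (continuous_iff_continuousAt.2 fun t =>
      (hasDerivAt_halfLineParam hφ hb t).continuousAt) ?_ h
    exact ((tendsto_halfLineParam_atBot hφ hb).eventually (gt_mem_nhds hs0)).exists.imp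
      fun _ h => h.le

/-- The chart of the half line with density `exp (halfLineLog φ)`. -/
def halfLineChart {φ : ℕ → Icc (0 : ℝ) 1 → ℝ} (hφ : IsDensitySeq φ)
    (hb : ∀ k x, |φ k x| ≤ Real.log (1 + k)) : Chart (Ici (0 : ℝ)) where
  X t := ⟨halfLineParam φ t, (halfLineParam_pos hφ hb t).le⟩
  strictMono := fun s t h => halfLineParam_strictMono hφ hb h
  cover := fun s => by
    by_cases hs : (s : ℝ) = 0
    · refine Or.inr (Or.inl fun t => ?_)
      change (s : ℝ) < halfLineParam φ t
      rw [hs]; exact halfLineParam_pos hφ hb t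
    · rcases halfLineParam_cover hφ hb s hs with ⟨t, ht⟩ | h
      · exact Or.inl ⟨t, Subtype.ext ht⟩
      · exact Or.inr (Or.inr h)

/-- Serves both for the contraction (`g = 1`, `c = -1`) and for its centralizer (`c = 0`). Only the
limit at `-∞` matters, because the chart fills the whole open half line; there the logarithmic
derivative is a coboundary of `negLog`, small by bounded displacement, plus the term controlled by
`hlim`. -/
theorem hasLogDeriv_halfLineChart {φ : ℕ → Icc (0 : ℝ) 1 → ℝ} (hφ : IsDensitySeq φ)
    (hb : ∀ k x, |φ k x| ≤ Real.log (1 + k)) (h0 : ∀ x, φ 0 x = 0) (c : ℤ)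
    {g : Icc (0 : ℝ) 1 ≃o Icc (0 : ℝ) 1} {u : Icc (0 : ℝ) 1 → ℝ} (hu : HasLogDeriv g u)
    (hu0 : u 0 = 0) (hu1 : u 1 = 0)
    (hlim : ∀ ε > 0, ∃ R : ℝ, ∀ m : ℤ, (m : ℝ) < -R → ∀ x,
      |u x + φ (-(m + c)).toNat (g x) - φ (-m).toNat x| ≤ ε) :
    ∃ v, HasLogDeriv ((halfLineChart hφ hb).ext (glue c fun _ => g)) v := by
  set C := halfLineChart hφ hb with hC
  set V : ℝ → ℝ := fun t => halfLineLog φ (glue c (fun _ => g) t) - halfLineLog φ t +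
    cells (fun _ => u) t with hV
  have hVc : Continuous V :=
    (((continuous_halfLineLog hφ).comp (glue c fun _ => g).continuous).sub
      (continuous_halfLineLog hφ)).add (continuous_cells (fun _ => hu.1) (fun _ => hu0) fun _ => hu1)
  have hVlim : Tendsto V atBot (𝓝 0) := by
    rw [Metric.tendsto_nhds]
    intro ε hε
    obtain ⟨R, hR⟩ := hlim (ε / 4) (by positivity)
    set N : ℝ := 4 * (|(c : ℝ)| + 1) / (ε / 4) with hN
    have hNpos : 0 < N := by positivity
    filter_upwards [eventually_lt_atBot (-(N + |(c : ℝ)| + 1)), eventually_lt_atBot (-R)]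
      with t ht1 ht2
    have h1 := abs_le.1 (abs_glue_sub_le c (fun _ => g) t)
    have h2 := abs_negLog_sub_le hNpos (s := glue c (fun _ => g) t) (t := t) (by linarith [h1.2])
      (by linarith [abs_nonneg (c : ℝ)])
    have h3 : 4 * |glue c (fun _ => g) t - t| / N ≤ ε / 4 := by
      rw [div_le_iff₀ hNpos, hN, mul_div_cancel₀ _ (by positivity)]
      linarith [abs_glue_sub_le c (fun _ => g) t]
    rw [Real.dist_eq, sub_zero]
    have h4 : V t = (negLog (glue c (fun _ => g) t) - negLog t) +
        (u ⟨Int.fract t, Int.fract_nonneg t, (Int.fract_lt_one t).le⟩ +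
        φ (-(⌊t⌋ + c)).toNat (g ⟨Int.fract t, Int.fract_nonneg t, (Int.fract_lt_one t).le⟩) -
        φ (-⌊t⌋).toNat ⟨Int.fract t, Int.fract_nonneg t, (Int.fract_lt_one t).le⟩) := by
      obtain ⟨m, x, hx, rfl⟩ := exists_int_add t
      have h5 := halfLineLog_add hφ (m + c) (g x)
      push_cast at h5
      simp only [hV, floor_int_add hx, fract_int_add hx]
      rw [glue_add, h5, halfLineLog_add hφ, cells_add (fun _ => hu0) (fun _ => hu1)]
      ring
    have h5 := hR ⌊t⌋ (by linarith [Int.floor_le t])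
      ⟨Int.fract t, Int.fract_nonneg t, (Int.fract_lt_one t).le⟩
    rw [h4]
    refine (abs_add_le _ _).trans_lt ?_
    linarith
  have htop : ∀ s, ¬ ∀ t, C.X t < s := fun s hs => by
    obtain ⟨t, ht⟩ := exists_lt_halfLineParam hφ hb h0 s
    exact absurd (hs t) (show (s : ℝ) < halfLineParam φ t from ht).not_gt
  refine ⟨C.lift V, C.hasLogDeriv_ext isClosed_Ici ?_ (countable_range ((↑) : ℤ → ℝ))
    (a := halfLineLog φ) (b := cells fun _ => u) (fun t _ => hasDerivAt_halfLineParam hφ hb t)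
    (fun t => hasDerivAt_glue fun _ => hu) (fun t => glue_notMem_range_int c _)
    (fun t => Ici_mem_nhds (halfLineParam_pos hφ hb t)) ?_ fun t _ => by rw [Chart.lift_X]⟩
  · refine (countable_singleton (⟨0, self_mem_Ici⟩ : Ici (0 : ℝ))).mono fun s hs => ?_
    by_contra h'
    have h : (s : ℝ) ≠ 0 := fun h => h' (Subtype.ext h)
    rcases halfLineParam_cover hφ hb s h with ⟨t, ht⟩ | h'
    · exact hs ⟨t, Subtype.ext ht⟩
    · exact htop s h'
  · exact C.continuous_lift hVc (fun _ _ => hVlim) fun s hs => absurd hs (htop s)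

/-- A group that is close to the identity embeds in the centralizer of a contraction. -/
theorem exists_contraction_centralizer {ψ : ℕ → Icc (0 : ℝ) 1 → ℝ} (hψ : IsDensitySeq ψ) :
    ∃ f : Ici (0 : ℝ) ≃o Ici (0 : ℝ), IsC1Contraction f ∧
      ∃ Φ : (Icc (0 : ℝ) 1 ≃o Icc (0 : ℝ) 1) →* (Ici (0 : ℝ) ≃o Ici (0 : ℝ)),
        Function.Injective Φ ∧ ∀ g ∈ closeGroup ψ, Φ g ∈ C1Centralizer f := by
  obtain ⟨φ, hφ, h0, hb, hslow, hφψ⟩ := exists_slow_densitySeq hψ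
  set C := halfLineChart hφ hb with hC
  have hu : UniqueDiffOn ℝ (Ici (0 : ℝ)) := uniqueDiffOn_Ici 0
  have htoNat : ∀ {k₀ : ℕ} {m : ℤ}, (m : ℝ) < -(k₀ : ℝ) → k₀ ≤ (-m).toNat := by
    intro k₀ m hm
    have : m < -(k₀ : ℤ) := by exact_mod_cast hm
    omega
  refine ⟨C.ext (glue (-1) 1), ⟨?_, ?_⟩, C.ext.comp (glueHom.comp
    (Pi.constMonoidHom ℤ (Icc (0 : ℝ) 1 ≃o Icc (0 : ℝ) 1))), ?_, fun g hg => ⟨?_, ?_⟩⟩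
  · obtain ⟨v, hv⟩ := hasLogDeriv_halfLineChart hφ hb h0 (-1) hasLogDeriv_one rfl rfl fun ε hε => by
      obtain ⟨k₀, hk₀⟩ := eventually_atTop.1 (hslow ε hε)
      refine ⟨k₀, fun m hm x => ?_⟩
      -- The contraction sends the cell of density index `k` to that of index `k + 1`, so its
      -- regularity at the origin is the slow variation of `φ`.
      have h1 : (-(m + -1)).toNat = (-m).toNat + 1 := by
        have : m < -(k₀ : ℤ) := by exact_mod_cast hm
        omega
      rw [h1, zero_add]
      exact hk₀ _ (htoNat hm) x
    exact hv.mem_Diff hu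
  · intro x hx
    rcases halfLineParam_cover hφ hb x hx with ⟨t, ht⟩ | h
    · obtain rfl : C.X t = x := Subtype.ext ht
      rw [Chart.ext_X]
      refine C.strictMono ?_
      obtain ⟨m, x, hx, rfl⟩ := exists_int_add t
      rw [glue_add]; simp
    · obtain ⟨t, ht⟩ := exists_lt_halfLineParam hφ hb h0 x
      exact absurd (h t) ht.not_gt
  · intro g g' h
    exact congrFun (glue_injective (C.ext_injective h)) 0
  · obtain ⟨u, hgu⟩ := hg
    -- In the cell `-k` the regularity at the origin is the smallness of `u + φ k ∘ g - φ k`: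
    -- closeness to the identity becomes differentiability at `0`.
    obtain ⟨hu', hu0, hu1, hlim⟩ := hφψ g u hgu
    obtain ⟨v, hv⟩ := hasLogDeriv_halfLineChart hφ hb h0 0 hu' hu0 hu1 fun ε hε => by
      obtain ⟨k₀, hk₀⟩ := eventually_atTop.1 (hlim ε hε)
      refine ⟨k₀, fun m hm x => ?_⟩
      rw [add_zero]
      exact hk₀ _ (htoNat hm) x
    exact hv.mem_Diff hu
  · refine Subgroup.mem_centralizer_singleton_iff.2 ?_
    change C.ext (glue 0 fun _ => g) * C.ext (glue (-1) 1) =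
      C.ext (glue (-1) 1) * C.ext (glue 0 fun _ => g)
    rw [← map_mul, ← map_mul, glue_mul, glue_mul]
    simp

end C1Interval

end

theorem theorem5 :
    (∃ G : Subgroup (Set.Icc (0 : ℝ) 1 ≃o Set.Icc (0 : ℝ) 1),
      Nonempty (G ≃* FreeGroup (Fin 2)) ∧
      C1Interval.C1CloseToId G ∧
      C1Interval.TotallyRational G) ∧
    (∃ f : Set.Ici (0 : ℝ) ≃o Set.Ici (0 : ℝ),
      C1Interval.IsC1Contraction f ∧
      ∃ H : Subgroup (Set.Ici (0 : ℝ) ≃o Set.Ici (0 : ℝ)),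
        H ≤ C1Interval.C1Centralizer f ∧
        Nonempty (H ≃* FreeGroup (Fin 2))) := by
  obtain ⟨ρ, ψ, hρ, hr, hψ, hclose⟩ := C1Interval.exists_faithful_representation (Fin 2)
  obtain ⟨f, hf, Φ, hΦ, hΦf⟩ := C1Interval.exists_contraction_centralizer hψ
  refine ⟨⟨ρ.range, ⟨(MonoidHom.ofInjective hρ).symm⟩,
    C1Interval.c1CloseToId_of_le_closeGroup hψ hclose, hr.totallyRational⟩, f, hf,
    (Φ.comp ρ).range, ?_, ⟨(MonoidHom.ofInjective (f := Φ.comp ρ) (hΦ.comp hρ)).symm⟩⟩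
  rintro _ ⟨w, rfl⟩
  exact hΦf _ (hclose ⟨w, rfl⟩)
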